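/- **Setting.** Let $\mathbb A$ be a countable relational structure over a finite vocabulary; its elements are called atoms. Consider the universe of sets with atoms: every object is either an atom or a set of objects (atoms are not sets, and sets are extensional). Ordered pairs are Kuratowski pairs $(x,y)=\{\{x,y\},\{x\}\}$, and tuples are iterated pairs. *Definable sets.* A set expression is either a variable or a formal finite (possibly empty) union of set-builder expressions $\{e \mid a_1,\dots,a_n\in\mathbb A,\ \varphi\}$, where $e$ is a set expression, $a_1,\dots,a_n$ are pairwise distinct variables (bound in $e$ and $\varphi$) and $\varphi$ is a first-order formula over the vocabulary of $\mathbb A$. Given a valuation of its free variables in $\mathbb A$, an expression has an obvious value. For a finite $S\subseteq\mathbb A$, an object is $S$-definable if it is the value of an expression under a valuation with values in $S$; it is definable if it is $S$-definable for some finite $S\subseteq\mathbb A$. *Definable structures.* A relational signature $\Sigma$ is a finite sequence of pairwise disjoint sets $\Sigma_1,\dots,\Sigma_l$, where $\Sigma_r$ is the (possibly infinite) set of symbols of arity $r$; it is $S$-definable if every $\Sigma_r$ is. A $\Sigma$-structure $\mathbb M$ consists of a set $M$ and, for each $r$, a set $I_r$ of tuples $(\sigma,a_1,\dots,a_r)$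 with $\sigma\in\Sigma_r$ and $a_1,\dots,a_r\in M$; the interpretation of $\sigma\in\Sigma_r$ is $\sigma^{\mathbb M}=\{(a_1,\dots,a_r)\mid(\sigma,a_1,\dots,a_r)\in I_r\}$. It is $S$-definable if $M,I_1,\dots,I_l$ are. An isomorphism of $\Sigma$-structures is a bijection of their universes that preserves and reflects $\sigma$ for every symbol $\sigma$; it is $S$-definable if its graph (a set of ordered pairs) is. *Assumptions on the atoms.* $\mathbb A$ is *$\omega$-categorical* if every countable structure satisfying the same first-order sentences is isomorphic to $\mathbb A$. A finite $S\subseteq\mathbb A$ *supports* an object $x$ if every automorphism $\pi$ of $\mathbb A$ that fixes $S$ pointwise satisfies $\pi x=x$, where $\pi$ acts on objects by renaming all atoms hereditarily; $\mathbb A$ has *least supports* if every definable $x$ has a least (under inclusion) finite support. $\mathbb A$ is *dense* if for all finite sets $T\subseteq S\subseteq\mathbb A$ there is an elementary embedding $H:\mathbb A\to\mathbb A$ fixing $T$ pointwise such that every automorphism of the induced substructure $H(\mathbb A)$ that fixes $T$ pointwise extends to an automorphism of $\mathbb A$ that fixes $S$ pointwise. **Theorem 3.1.** Let $\mathbb A$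 be a countable relational structure over a finite vocabulary that is $\omega$-categorical, dense, and has least supports. Then $\mathbb A$ has the parameter elimination property: for every finite $T\subseteq\mathbb A$, every $T$-definable relational signature $\Sigma$ and all $T$-definable $\Sigma$-structures $\mathbb M$ and $\mathbb N$, if there is a definable isomorphism $\mathbb M\to\mathbb N$ (that is, an $S$-definable one for some finite $S\subseteq\mathbb A$), then there is a $T$-definable isomorphism $\mathbb M\to\mathbb N$. -/

import Mathlib

open scoped FirstOrder

universe u v w

namespace SetsWithAtoms

/-! ### The universe of sets with atoms -/

/-- Names of objects of the cumulative hierarchy of sets built over the set `A` of atoms: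
an object is either an atom or a family of objects. -/
inductive PreObj (A : Type w) : Type (w + 1)
  | atom (a : A) : PreObj A
  | family (ι : Type w) (f : ι → PreObj A) : PreObj A

namespace PreObj

variable {A : Type w}

/-- Extensional equality of names. An atom is never equal to a set. -/
def Equiv : PreObj A → PreObj A → Prop
  | atom a, atom b => a = b
  | family _ f, family _ g => (∀ i, ∃ j, Equiv (f i) (g j)) ∧ (∀ j, ∃ i, Equiv (f i) (g j))
  | atom _, family _ _ => False
  | family _ _, atom _ => False

theorem Equiv.rfl' : ∀ x : PreObj A, Equiv x x
  | atom a => by simp [Equiv]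
  | family _ f => by
      simp only [Equiv]
      exact ⟨fun i => ⟨i, Equiv.rfl' (f i)⟩, fun i => ⟨i, Equiv.rfl' (f i)⟩⟩

theorem Equiv.euc : ∀ {x y z : PreObj A}, Equiv x y → Equiv z y → Equiv x z
  | atom a, atom b, atom c, h, h' => by
      simp only [Equiv] at h h' ⊢
      exact h.trans h'.symm
  | family _ f, family _ g, family _ k, h, h' => by
      simp only [Equiv] at h h' ⊢
      refine ⟨fun i => ?_, fun j => ?_⟩
      · obtain ⟨j, hj⟩ := h.1 i
        obtain ⟨l, hl⟩ := h'.2 j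
        exact ⟨l, Equiv.euc hj hl⟩
      · obtain ⟨l, hl⟩ := h'.1 j
        obtain ⟨i, hi⟩ := h.2 l
        exact ⟨i, Equiv.euc hi hl⟩
  | atom _, family _ _, _, h, _ => by simp [Equiv] at h
  | family _ _, atom _, _, h, _ => by simp [Equiv] at h
  | atom _, atom _, family _ _, _, h' => by simp [Equiv] at h'
  | family _ _, family _ _, atom _, _, h' => by simp [Equiv] at h'

theorem Equiv.symm' {x y : PreObj A} (h : Equiv x y) : Equiv y x :=
  Equiv.euc (Equiv.rfl' y) h

theorem Equiv.trans' {x y z : PreObj A} (h : Equiv x y) (h' : Equiv y z) : Equiv x z :=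
  Equiv.euc h h'.symm'

instance setoid (A : Type w) : Setoid (PreObj A) :=
  ⟨Equiv, Equiv.rfl', Equiv.symm', Equiv.trans'⟩

/-- Membership of names. -/
def Mem (x : PreObj A) : PreObj A → Prop
  | atom _ => False
  | family _ f => ∃ i, Equiv x (f i)

theorem Mem.congr {x x' y y' : PreObj A} (hx : Equiv x x') (hy : Equiv y y') :
    Mem x y ↔ Mem x' y' := by
  match y, y', hy with
  | atom _, atom _, _ => rfl
  | atom _, family _ _, h => simp [Equiv] at h
  | family _ _, atom _, h => simp [Equiv] at h
  | family _ f, family _ g, h =>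
    simp only [Equiv] at h
    simp only [Mem]
    constructor
    · rintro ⟨i, hi⟩
      obtain ⟨j, hj⟩ := h.1 i
      exact ⟨j, (hx.symm'.trans' hi).trans' hj⟩
    · rintro ⟨j, hj⟩
      obtain ⟨i, hi⟩ := h.2 j
      exact ⟨i, (hx.trans' hj).trans' hi.symm'⟩

/-- Renaming hereditarily all atoms of a name. -/
def map {B : Type w} (π : A → B) : PreObj A → PreObj B
  | atom a => atom (π a)
  | family ι f => family ι fun i => map π (f i)

theorem map_congr {B : Type w} (π : A → B) :
    ∀ {x y : PreObj A}, Equiv x y → Equiv (map π x) (map π y)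
  | atom a, atom b, h => by
      simp only [Equiv, map] at h ⊢
      rw [h]
  | atom _, family _ _, h => by simp [Equiv] at h
  | family _ _, atom _, h => by simp [Equiv] at h
  | family _ f, family _ g, h => by
      simp only [Equiv, map] at h ⊢
      refine ⟨fun i => ?_, fun j => ?_⟩
      · obtain ⟨j, hj⟩ := h.1 i
        exact ⟨j, map_congr π hj⟩
      · obtain ⟨i, hi⟩ := h.2 j
        exact ⟨i, map_congr π hi⟩

end PreObj

/-- The objects of the set-theoretic universe over the atoms `A`: atoms, and sets of objects. -/
def Obj (A : Type w) : Type (w + 1) := Quotient (PreObj.setoid A)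

namespace Obj

variable {A : Type w}

/-- An atom, as an object. -/
def atom (a : A) : Obj A := Quotient.mk _ (PreObj.atom a)

/-- Objects that are sets, i.e. not atoms. -/
def IsSet (x : Obj A) : Prop := ∀ a : A, x ≠ atom a

/-- The membership relation; atoms have no elements. -/
def Mem (x y : Obj A) : Prop :=
  Quotient.liftOn₂ x y PreObj.Mem fun _ _ _ _ h h' => propext (PreObj.Mem.congr h h')

instance : Membership (Obj A) (Obj A) := ⟨fun y x => Mem x y⟩

/-- The action on objects of a map between atoms: every atom occurring (as an element, as an
element of an element, and so on) is renamed. -/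
def map (π : A → A) (x : Obj A) : Obj A :=
  Quotient.map (PreObj.map π) (fun _ _ h => PreObj.map_congr π h) x

/-- The set `{f i | i ∈ ι}`. -/
noncomputable def range {ι : Type w} (f : ι → Obj A) : Obj A :=
  Quotient.mk _ (PreObj.family ι fun i => (f i).out)

theorem mem_range {ι : Type w} (f : ι → Obj A) (x : Obj A) : x ∈ range f ↔ ∃ i, f i = x := by
  induction x using Quotient.inductionOn with
  | h x =>
    change (∃ i, PreObj.Equiv x (f i).out) ↔ _
    refine exists_congr fun i => ⟨fun h => ?_, fun h => ?_⟩
    · rw [← Quotient.out_eq (f i)]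
      exact (Quotient.sound h).symm
    · rw [h]
      exact (Quotient.mk_out (s := PreObj.setoid A) x).symm'

theorem isSet_range {ι : Type w} (f : ι → Obj A) : IsSet (range f) := by
  intro a h
  have h' : PreObj.Equiv _ _ := Quotient.exact h
  simp [PreObj.Equiv] at h'

theorem atom_injective : Function.Injective (atom : A → Obj A) := by
  intro a b h
  have h' : PreObj.Equiv _ _ := Quotient.exact h
  simpa [PreObj.Equiv] using h'

/-- Extensionality for sets. -/
theorem ext_of_isSet {x y : Obj A} (hx : IsSet x) (hy : IsSet y) (h : ∀ z, z ∈ x ↔ z ∈ y) :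
    x = y := by
  induction x using Quotient.inductionOn with
  | h x =>
  induction y using Quotient.inductionOn with
  | h y =>
  match x, y with
  | .atom a, _ => exact absurd rfl (hx a)
  | _, .atom b => exact absurd rfl (hy b)
  | .family _ f, .family _ g =>
    apply Quotient.sound
    change PreObj.Equiv _ _
    simp only [PreObj.Equiv]
    refine ⟨fun i => ?_, fun j => ?_⟩
    · exact (h (Quotient.mk _ (f i))).1 ⟨i, PreObj.Equiv.rfl' _⟩
    · obtain ⟨i, hi⟩ := (h (Quotient.mk _ (g j))).2 ⟨j, PreObj.Equiv.rfl' _⟩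
      exact ⟨i, hi.symm'⟩

/-- The unordered pair `{x, y}`. -/
noncomputable def upair (x y : Obj A) : Obj A :=
  range fun b : ULift.{w} Bool => cond b.down x y

/-- The Kuratowski pair `(x, y) = {{x, y}, {x}}`. -/
noncomputable def pair (x y : Obj A) : Obj A := upair (upair x y) (upair x x)

/-- Nonempty tuples, encoded by iterating pairs:
`(x₀) = x₀` and `(x₀, x₁, …) = (x₀, (x₁, …))`. -/
noncomputable def tuple : {n : ℕ} → (Fin (n + 1) → Obj A) → Obj A
  | 0, x => x 0
  | _ + 1, x => pair (x 0) (tuple (Fin.tail x))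

end Obj

/-! ### Definable sets -/

/-- Set expressions with free variables in `α`: a variable, or a formal finite (possibly empty)
union of `m` set-builder expressions `{eᵢ | a₁, …, aₙ ∈ A, φᵢ}` where `n = n i`; the bound
variables are represented by `Fin (n i)`. -/
inductive SetExpr (L : FirstOrder.Language.{u, v}) : Type → Type (max 1 u v)
  | var {α : Type} (x : α) : SetExpr L α
  | union {α : Type} (m : ℕ) (n : Fin m → ℕ) (e : ∀ i, SetExpr L (α ⊕ Fin (n i)))
      (φ : ∀ i, L.Formula (α ⊕ Fin (n i))) : SetExpr L α

section

variable (L : FirstOrder.Language.{u, v}) {A : Type w} [L.Structure A]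

/-- The value of an expression under a valuation of its free variables. -/
noncomputable def SetExpr.value {L : FirstOrder.Language.{u, v}} {A : Type w} [L.Structure A] :
    {α : Type} → SetExpr L α → (α → A) → Obj A
  | _, .var x, val => Obj.atom (val x)
  | _, .union m n e φ, val =>
      Obj.range fun p : (Σ i : Fin m, {b : Fin (n i) → A // (φ i).Realize (Sum.elim val b)}) =>
        (e p.1).value (Sum.elim val p.2.1)

/-- `x` is `S`-definable: it is the value of an expression whose variables are evaluated in `S`. -/
def DefinableOver (S : Finset A) (x : Obj A) : Prop :=
  ∃ (k : ℕ) (e : SetExpr L (Fin k)) (val : Fin k → A), (∀ i, val i ∈ S) ∧ e.value val = x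

/-! ### Assumptions on the atoms -/

/-- `A` is `ω`-categorical: every countable structure satisfying the same first-order sentences
is isomorphic to it. (A countable structure has a copy in every universe.) -/
def OmegaCategorical (A : Type w) [L.Structure A] : Prop :=
  ∀ (N : Type w) [L.Structure N] [Countable N], A ≅[L] N → Nonempty (A ≃[L] N)

/-- `S` supports `x`: every automorphism of the atoms fixing `S` pointwise fixes `x`. -/
def Supports (S : Finset A) (x : Obj A) : Prop :=
  ∀ π : A ≃[L] A, (∀ s ∈ S, π s = s) → Obj.map π x = x

/-- Every definable set has a least finite support with respect to inclusion. -/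
def HasLeastSupports (A : Type w) [L.Structure A] : Prop :=
  ∀ x : Obj A, (∃ S : Finset A, DefinableOver L S x) →
    ∃ S : Finset A, IsLeast {S' : Finset A | Supports L S' x} S

/-- `A` is dense: for all finite sets `T ⊆ S` of atoms there is a self-embedding `H`
(an elementary embedding of `A` into itself) fixing `T` pointwise, such that every automorphism
of the structure `H(A)` that fixes `T` pointwise extends to an automorphism of `A` that fixes
`S` pointwise. -/
def DenseAtoms (A : Type w) [L.Structure A] : Prop :=
  ∀ T S : Finset A, T ⊆ S →
    ∃ H : A ↪ₑ[L] A, (∀ t ∈ T, H t = t) ∧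
      ∀ ρ : H.toHom.range ≃[L] H.toHom.range,
        (∀ x : H.toHom.range, (x : A) ∈ T → (ρ x : A) = x) →
        ∃ τ : A ≃[L] A, (∀ s ∈ S, τ s = s) ∧ ∀ x : H.toHom.range, τ x = (ρ x : A)

end

/-! ### Definable relational structures -/

/-- A relational signature inside the universe of sets with atoms: pairwise disjoint sets of
symbols, `symbols r` being the set of symbols of arity `r + 1`, for `r < maxArity`. -/
structure RelSignature (A : Type w) where
  maxArity : ℕ
  symbols : Fin maxArity → Obj A
  isSet_symbols : ∀ r, (symbols r).IsSet
  disjoint : ∀ r r', r ≠ r' → ∀ σ, σ ∈ symbols r → σ ∉ symbols r'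

/-- A relational structure over the signature `Sg`, given by its universe and, for each arity
`r + 1`, the set `interp r` of all tuples `(σ, a₀, …, aᵣ)` such that the symbol `σ` of arity
`r + 1` holds of `(a₀, …, aᵣ)`. -/
structure RelStructure {A : Type w} (Sg : RelSignature A) where
  carrier : Obj A
  isSet_carrier : carrier.IsSet
  interp : Fin Sg.maxArity → Obj A
  isSet_interp : ∀ r, (interp r).IsSet
  mem_interp : ∀ r, ∀ z ∈ interp r, ∃ σ ∈ Sg.symbols r, ∃ a : Fin (r + 1) → Obj A,
    (∀ i, a i ∈ carrier) ∧ z = Obj.tuple (Fin.cons σ a : Fin (r + 2) → Obj A)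

/-- The elements of the universe of a structure. -/
def RelStructure.Elem {A : Type w} {Sg : RelSignature A} (M : RelStructure Sg) : Type (w + 1) :=
  {x : Obj A // x ∈ M.carrier}

/-- The relation interpreting the symbol `σ` of arity `r + 1`. -/
def RelStructure.Holds {A : Type w} {Sg : RelSignature A} (M : RelStructure Sg)
    (r : Fin Sg.maxArity) (σ : Obj A) (a : Fin (r + 1) → M.Elem) : Prop :=
  Obj.tuple (Fin.cons σ fun i => (a i).1 : Fin (r + 2) → Obj A) ∈ M.interp r

/-- A bijection of the universes that preserves and reflects all relations of the signature. -/
def IsIsomorphism {A : Type w} {Sg : RelSignature A} (M N : RelStructure Sg)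
    (h : M.Elem ≃ N.Elem) : Prop :=
  ∀ (r : Fin Sg.maxArity) (σ : Obj A), σ ∈ Sg.symbols r → ∀ a : Fin (r + 1) → M.Elem,
    M.Holds r σ a ↔ N.Holds r σ fun i => h (a i)

section

variable (L : FirstOrder.Language.{u, v}) {A : Type w} [L.Structure A] (S : Finset A)

/-- The sets of symbols of each arity are `S`-definable. -/
def RelSignature.IsDefinable (Sg : RelSignature A) : Prop :=
  ∀ r, DefinableOver L S (Sg.symbols r)

/-- The universe and the interpretation are `S`-definable. -/
def RelStructure.IsDefinable {Sg : RelSignature A} (M : RelStructure Sg) : Prop :=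
  DefinableOver L S M.carrier ∧ ∀ r, DefinableOver L S (M.interp r)

/-- The graph of the function `h` between the universes of two structures is an
`S`-definable set. -/
def IsDefinableFun {Sg : RelSignature A} {M N : RelStructure Sg} (h : M.Elem → N.Elem) : Prop :=
  ∃ Γ : Obj A, Γ.IsSet ∧ (∀ z, z ∈ Γ ↔ ∃ x : M.Elem, z = Obj.pair x.1 (h x).1) ∧
    DefinableOver L S Γ

/-- The two structures are related by an `S`-definable isomorphism. -/
def DefinablyIsomorphic {Sg : RelSignature A} (M N : RelStructure Sg) : Prop :=
  ∃ h : M.Elem ≃ N.Elem, IsIsomorphism M N h ∧ IsDefinableFun L S h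

end

/-- Parameter elimination: for every finite set `T` of atoms, if two `T`-definable structures over
a `T`-definable signature are related by a definable isomorphism, then they are also related by a
`T`-definable one. -/
def ParameterElimination (L : FirstOrder.Language.{u, v}) (A : Type w) [L.Structure A] : Prop :=
  ∀ (T : Finset A) (Sg : RelSignature A) (M N : RelStructure Sg),
    Sg.IsDefinable L T → M.IsDefinable L T → N.IsDefinable L T →
    (∃ S : Finset A, DefinablyIsomorphic L S M N) → DefinablyIsomorphic L T M N

end SetsWithAtoms

/-!
Parameter elimination is reduced to a statement about group actions, which is proved by counting.

*Model theory.* If a tuple of a countable `ω`-categorical structure had a non-isolated type, a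
generic countable model of the same theory would omit it (`exists_generic_model`,
`exists_isolating_formula`), although that model is isomorphic to the structure. Hence there are
finitely many types of `n`-tuples, tuples of the same type are conjugate under automorphisms, orbits
of tuples are definable, and elementary self-embeddings agree with automorphisms on finite sets. It
follows that definable sets are orbit-finite and that finite unions of orbits of definable objects
under the pointwise stabilizer of `T` are `T`-definable (`exists_definableOver_orbits`). It
therefore suffices to find an isomorphism equivariant under the stabilizer of `T`.

*Counting.* Let `h : M → N` be an isomorphism with parameters `S`, let `m` be a large number, and
let `h₁, …, hₘ` be conjugates of `h` over `T` with parameters `S₁, …, Sₘ` that are disjoint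
outside `T`, after discarding the atoms fixed by every automorphism, which never matter. Density
gives `H : A → A` such that each automorphism over `T` is carried by `H` to one that fixes all the
`Sᵢ`. For `X = M` and `X = N` consider the maps `M → X` that are embeddings and equivariant along
`H` (`IsShifted`). Least supports assign to each such map the set of indices `i` such that
parameters from `Sᵢ` are used, and orbit-finiteness bounds the size of this set by a number less
than `m`. For nonempty `I`, composition with some `hᵢ`, `i ∈ I`, shows that the maps using only
indices in `I` are equally many for `M` and for `N`. Since no map uses all the indices,
inclusion-exclusion turns these equalities into the one for `I = ∅` (`card_eq_of_card_subset_eq`).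
The action of `H` itself is a map `M → M` using no index, so there is such a map `M → N`; its
values are of the form `H (i x)`, and `i : M → N` is an embedding equivariant over `T`
(`exists_equivariant_embedding`).

*Conclusion.* With equivariant embeddings in both directions, a composite `N → M → N` has an
iterate equal to the identity, as there are finitely many equivariant maps `N → N`, so the embedding
`M → N` is onto (`exists_equivariant_isomorphism`).
-/

namespace SetsWithAtoms

open FirstOrder FirstOrder.Language

section ModelTheory

variable {L : FirstOrder.Language.{u, v}} {A : Type w} [L.Structure A]

/-! ### Generic countable models -/

theorem countable_formula [Finite L.Symbols] (α : Type) [Countable α] :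
    Countable (L.Formula α) := by
  have h : Countable (Σ n, L.BoundedFormula α n) := by
    rw [← Cardinal.mk_le_aleph0_iff]
    refine BoundedFormula.card_le.trans (max_le le_rfl ?_)
    have h2 : L.card ≤ Cardinal.aleph0 := Cardinal.mk_le_aleph0
    rw [← Cardinal.aleph0_add_aleph0]
    exact add_le_add (by simp) (by simpa using h2)
  exact Function.Injective.countable (f := fun φ : L.Formula α =>
    (⟨0, φ⟩ : Σ n, L.BoundedFormula α n)) fun _ _ h => by simpa using h

/-- A formula mentions only finitely many variables. -/
theorem exists_formula_fin (φ : L.Formula ℕ) (k : ℕ) :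
    ∃ m, k ≤ m ∧ ∃ φ' : L.Formula (Fin m),
      ∀ v : ℕ → A, φ'.Realize (fun i => v i) ↔ φ.Realize v := by
  have hlt : ∀ x : φ.freeVarFinset, (x : ℕ) < k + φ.freeVarFinset.sup id + 1 := fun x => by
    have := Finset.le_sup (f := id) x.2
    simp only [id] at this
    omega
  exact ⟨k + φ.freeVarFinset.sup id + 1, by omega, φ.restrictFreeVar fun x => ⟨x, hlt x⟩,
    fun v => BoundedFormula.realize_restrictFreeVar v fun _ => rfl⟩

variable (L A) in
/-- Formulas in the variables `x₀, x₁, …` that are satisfiable in `A`: the finite pieces of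
information about a countable model of the theory of `A` enumerated as `x₀, x₁, …`. -/
def Condition : Type (max u v) := {φ : L.Formula ℕ // ∃ v : ℕ → A, φ.Realize v}

/-- A condition is larger when it carries more information. -/
instance : Preorder (Condition L A) where
  le φ ψ := ∀ v : ℕ → A, ψ.1.Realize v → φ.1.Realize v
  le_refl _ _ h := h
  le_trans _ _ _ h h' v hv := h v (h' v hv)

/-- The conditions that decide whether `F(x_{u 0}, …, x_{u (n-1)}, y)` has a solution `y`, and name
one by a variable if there is one. -/
theorem isCofinal_witness {n : ℕ} (F : L.Formula (Fin (n + 1))) (u : Fin n → ℕ) :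
    IsCofinal {φ : Condition L A |
      (∀ v : ℕ → A, φ.1.Realize v → ∀ c, ¬ F.Realize (Fin.snoc (v ∘ u) c : Fin (n + 1) → A)) ∨
      ∃ j, ∀ v : ℕ → A, φ.1.Realize v → F.Realize (Fin.snoc (v ∘ u) (v j) : Fin (n + 1) → A)} := by
  rintro ⟨φ, v, hv⟩
  by_cases hc : ∃ c, F.Realize (Fin.snoc (v ∘ u) c : Fin (n + 1) → A)
  · obtain ⟨c, hc⟩ := hc
    obtain ⟨m, hm, φ', hφ'⟩ := exists_formula_fin (A := A) φ (Finset.univ.sup u + 1)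
    have hu : ∀ i, u i ≠ m := fun i => by
      have := Finset.le_sup (f := u) (Finset.mem_univ i)
      omega
    let g : Fin (n + 1) → ℕ := Fin.snoc u m
    have hg : ∀ v' : ℕ → A, v' ∘ g = (Fin.snoc (v' ∘ u) (v' m) : Fin (n + 1) → A) :=
      fun v' => Fin.comp_snoc v' u m
    have hr : (φ ⊓ F.relabel g).Realize (Function.update v m c) := by
      rw [Formula.realize_inf, Formula.realize_relabel, hg]
      constructor
      · rw [← hφ'] at hv ⊢
        convert hv using 2 with i
        exact Function.update_of_ne i.2.ne _ _
      · convert hc using 2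
        · funext i
          exact Function.update_of_ne (hu i) _ _
        · simp
    refine ⟨⟨φ ⊓ F.relabel g, _, hr⟩, Or.inr ⟨m, fun v' hv' => ?_⟩, fun v' hv' => ?_⟩
    · rw [Formula.realize_inf, Formula.realize_relabel, hg] at hv'
      exact hv'.2
    · exact (Formula.realize_inf.1 hv').1
  · let g : Fin (n + 1) → ℕ ⊕ Fin 1 := Fin.snoc (fun i => Sum.inl (u i)) (Sum.inr 0)
    have hg : ∀ (v' : ℕ → A) (c : Fin 1 → A),
        Sum.elim v' c ∘ g = (Fin.snoc (v' ∘ u) (c 0) : Fin (n + 1) → A) := fun v' c => by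
      rw [Fin.comp_snoc]
      rfl
    have hχ : ∀ v' : ℕ → A, ((F.relabel g).iExs (Fin 1)).not.Realize v' ↔
        ∀ c, ¬ F.Realize (Fin.snoc (v' ∘ u) c : Fin (n + 1) → A) := fun v' => by
      rw [Formula.realize_not, Formula.realize_iExs]
      simp only [Formula.realize_relabel, hg, not_exists]
      exact ⟨fun h c => h fun _ => c, fun h c => h (c 0)⟩
    refine ⟨⟨φ ⊓ ((F.relabel g).iExs (Fin 1)).not, v, ?_⟩, Or.inl fun v' hv' => ?_,
      fun v' hv' => (Formula.realize_inf.1 hv').1⟩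
    · rw [Formula.realize_inf, hχ]
      exact ⟨hv, not_exists.1 hc⟩
    · exact (hχ v').1 (Formula.realize_inf.1 hv').2

/-- A generic countable model of the theory of `A`: given countably many cofinal sets of
conditions, there is a countable model, enumerated by `v`, such that each of these sets contains a
condition all of whose consequences hold of `v`. -/
theorem exists_generic_model [L.IsRelational] [Finite L.Symbols] [Nonempty A]
    {κ : Type} [Countable κ] (D : κ → Set (Condition L A)) (hD : ∀ k, IsCofinal (D k)) :
    ∃ (N : Type w) (_ : L.Structure N), Countable N ∧ (A ≅[L] N) ∧
      ∃ v : ℕ → N, Function.Surjective v ∧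
        ∀ k, ∃ φ ∈ D k, ∀ ψ : L.Formula ℕ, (∀ v' : ℕ → A, φ.1.Realize v' → ψ.Realize v') →
          ψ.Realize v := by
  have : ∀ n, Countable (L.Formula (Fin (n + 1))) := fun n => countable_formula _
  let W : (Σ n, L.Formula (Fin (n + 1)) × (Fin n → ℕ)) → Order.Cofinal (Condition L A) :=
    fun p => ⟨_, isCofinal_witness p.2.1 p.2.2⟩
  let E : ((Σ n, L.Formula (Fin (n + 1)) × (Fin n → ℕ)) ⊕ κ) → Order.Cofinal (Condition L A) :=
    Sum.elim W fun k => ⟨D k, hD k⟩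
  let _ := Encodable.ofCountable ((Σ n, L.Formula (Fin (n + 1)) × (Fin n → ℕ)) ⊕ κ)
  let p₀ : Condition L A := ⟨⊤, fun _ => Classical.arbitrary A, by simp⟩
  let s := Order.sequenceOfCofinals p₀ E
  have hs : Monotone s := Order.sequenceOfCofinals.monotone p₀ E
  choose z hz using fun k => (s k).2
  have hmem : ∀ i, ∃ k, s k ∈ E i := fun i => ⟨_, Order.sequenceOfCofinals.encode_mem p₀ E i⟩
  -- In an ultrapower along the generic sequence, the diagonal assignment satisfies all its
  -- consequences, and the values of the variables form an elementary substructure.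
  let U : Ultrafilter ℕ := Filter.hyperfilter ℕ
  let B : Type w := (U : Filter ℕ).Product fun _ => A
  let y : ℕ → B := fun j => ((fun k => z k j : ℕ → A) : B)
  have hev : ∀ k, ∀ᶠ l in (U : Filter ℕ), k ≤ l := fun k =>
    Nat.hyperfilter_le_atTop (Filter.eventually_ge_atTop k)
  have hB : ∀ k, ∀ᶠ l in (U : Filter ℕ), (s k).1.Realize (z l) := fun k => by
    filter_upwards [hev k] with l hl
    exact hs hl _ (hz l)
  have hy : ∀ (k : ℕ) (ψ : L.Formula ℕ), (∀ v' : ℕ → A, (s k).1.Realize v' → ψ.Realize v') →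
      ψ.Realize y := fun k ψ h => by
    refine (Ultraproduct.realize_formula_cast ψ fun j l => z l j).2 ?_
    filter_upwards [hB k] with l hl
    exact h _ hl
  let R : L.Substructure B := Substructure.closure L (Set.range y)
  have hR : ∀ b : B, b ∈ R ↔ ∃ j, y j = b := fun b =>
    Substructure.mem_closure_iff_of_isRelational L _ _
  have hRel : R.IsElementary := by
    refine R.isElementary_of_exists fun n φ x b hb => ?_
    choose u hu using fun i => (hR (x i)).1 (x i).2
    let F : L.Formula (Fin (n + 1)) := φ.toFormula.relabel (Sum.elim Empty.elim id)
    have hF : ∀ c : Fin (n + 1) → B, F.Realize c ↔ φ.Realize default c := fun c => by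
      rw [Formula.realize_relabel, BoundedFormula.realize_toFormula]
      rw [Unique.eq_default ((c ∘ Sum.elim Empty.elim id) ∘ Sum.inl)]
      rfl
    have hx : ((↑) ∘ x : Fin n → B) = y ∘ u := funext fun i => (hu i).symm
    rw [hx] at hb ⊢
    rw [← hF] at hb
    obtain ⟨k, hk | ⟨j, hj⟩⟩ := hmem (Sum.inl ⟨n, F, u⟩)
    · induction b using Quotient.inductionOn with
      | h c =>
      have h1 : ∀ᶠ l in (U : Filter ℕ),
          F.Realize (fun i => (Fin.snoc (fun i l => z l (u i)) c : Fin (n + 1) → ℕ → A) i l) := by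
        rw [← Ultraproduct.realize_formula_cast]
        have e : (fun i => ((Fin.snoc (fun i l => z l (u i)) c : Fin (n + 1) → ℕ → A) i : B)) =
            Fin.snoc (y ∘ u) (c : B) :=
          Fin.comp_snoc (fun f : ℕ → A => (f : B)) (fun i l => z l (u i)) c
        exact e ▸ hb
      obtain ⟨l, hl, hl'⟩ := (h1.and (hB k)).exists
      have e : (fun i => (Fin.snoc (fun i l => z l (u i)) c : Fin (n + 1) → ℕ → A) i l) =
          Fin.snoc (z l ∘ u) (c l) :=
        Fin.comp_snoc (fun f : ℕ → A => f l) (fun i l => z l (u i)) c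
      exact absurd (e ▸ hl) (hk _ hl' (c l))
    · refine ⟨⟨y j, (hR _).2 ⟨j, rfl⟩⟩, ?_⟩
      rw [← hF]
      have h2 := hy k (F.relabel (Fin.snoc u j : Fin (n + 1) → ℕ)) fun v' hv' => by
        rw [Formula.realize_relabel, Fin.comp_snoc]
        exact hj v' hv'
      rwa [Formula.realize_relabel, Fin.comp_snoc] at h2
  have hAB : A ≅[L] B := by
    rw [elementarilyEquivalent_iff]
    intro φ
    rw [Ultraproduct.sentence_realize]
    simp
  let R' : L.ElementarySubstructure B := ⟨R, hRel⟩
  have hBR : R' ≅[L] B := R'.elementarilyEquivalent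
  have hcount : Countable R := by
    have : (R : Set B) = Set.range y := Set.ext fun b => hR b
    exact (this ▸ Set.countable_range y : (R : Set B).Countable).to_subtype
  refine ⟨R, inferInstance, hcount, hAB.trans hBR.symm,
    fun j => ⟨y j, (hR _).2 ⟨j, rfl⟩⟩, fun b => ?_, fun k => ?_⟩
  · obtain ⟨j, hj⟩ := (hR b).1 b.2
    exact ⟨j, Subtype.ext hj⟩
  · obtain ⟨l, hl⟩ := hmem (Sum.inr k)
    refine ⟨s l, hl, fun ψ hψ => ?_⟩
    exact (R'.subtype.map_formula ψ fun j => (⟨y j, (hR _).2 ⟨j, rfl⟩⟩ : R')).1 (hy l ψ hψ)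

/-! ### Types and orbits in `ω`-categorical structures -/

/-- The conditions refuting that the variables `x_{u 0}, …, x_{u (n-1)}` have the type of `a`, when
this type is not isolated. -/
theorem isCofinal_omit {n : ℕ} (a : Fin n → A)
    (ha : ∀ φ : L.Formula (Fin n), φ.Realize a →
      ∃ b : Fin n → A, φ.Realize b ∧ ∃ ψ : L.Formula (Fin n), ψ.Realize a ∧ ¬ ψ.Realize b)
    (u : Fin n → ℕ) :
    IsCofinal {φ : Condition L A | ∃ ψ : L.Formula (Fin n), ¬ ψ.Realize a ∧
      ∀ v : ℕ → A, φ.1.Realize v → ψ.Realize (v ∘ u)} := by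
  rintro ⟨φ, v, hv⟩
  by_cases hψ : ∃ ψ : L.Formula (Fin n), ψ.Realize (v ∘ u) ∧ ¬ ψ.Realize a
  · obtain ⟨ψ, h1, h2⟩ := hψ
    refine ⟨⟨φ ⊓ ψ.relabel u, v, ?_⟩, ⟨ψ, h2, fun v' hv' => ?_⟩,
      fun v' hv' => (Formula.realize_inf.1 hv').1⟩
    · rw [Formula.realize_inf, Formula.realize_relabel]
      exact ⟨hv, h1⟩
    · rw [Formula.realize_inf, Formula.realize_relabel] at hv'
      exact hv'.2
  · push Not at hψ
    obtain ⟨m, hm, φ', hφ'⟩ := exists_formula_fin (A := A) φ (Finset.univ.sup u + 1)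
    have hu : ∀ i, u i < m := fun i => by
      have := Finset.le_sup (f := u) (Finset.mem_univ i)
      omega
    -- `χ(y)` says that `y` is the tuple at the positions `u` of some solution of `φ`.
    let χ : L.Formula (Fin n) := ((φ'.relabel Sum.inr) ⊓
      Formula.iInf fun i => Term.equal (Term.var (Sum.inl i)) (Term.var (Sum.inr ⟨u i, hu i⟩)) :
        L.Formula (Fin n ⊕ Fin m)).iExs (Fin m)
    have hχ : ∀ b : Fin n → A, χ.Realize b ↔
        ∃ x : Fin m → A, φ'.Realize x ∧ ∀ i, b i = x ⟨u i, hu i⟩ := fun b => by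
      simp only [χ, Formula.realize_iExs, Formula.realize_inf, Formula.realize_relabel,
        Formula.realize_iInf, Formula.realize_equal, Term.realize_var, Sum.elim_inl, Sum.elim_inr,
        Sum.elim_comp_inr]
    obtain ⟨b, hb, ψ, h1, h2⟩ := ha χ (hψ χ ((hχ _).2 ⟨fun i => v i, (hφ' v).2 hv, fun _ => rfl⟩))
    obtain ⟨x, hx, hbx⟩ := (hχ b).1 hb
    let v' : ℕ → A := fun j => if h : j < m then x ⟨j, h⟩ else v j
    have hv'x : (fun i : Fin m => v' i) = x := funext fun i => by simp [v']
    have hv'b : v' ∘ u = b := funext fun i => by simp [v', hu i, hbx i]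
    refine ⟨⟨φ ⊓ ψ.not.relabel u, v', ?_⟩, ⟨ψ.not, ?_, fun v'' hv'' => ?_⟩,
      fun v'' hv'' => (Formula.realize_inf.1 hv'').1⟩
    · rw [Formula.realize_inf, Formula.realize_relabel, hv'b, ← hφ', hv'x, Formula.realize_not]
      exact ⟨hx, h2⟩
    · rwa [Formula.realize_not, not_not]
    · rw [Formula.realize_inf, Formula.realize_relabel] at hv''
      exact hv''.2

/-- In an `ω`-categorical structure the type of every tuple is isolated: otherwise the omitting
types construction yields a countable model, hence a copy of `A`, omitting it. -/
theorem exists_isolating_formula [L.IsRelational] [Finite L.Symbols]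
    (hcat : OmegaCategorical L A) {n : ℕ} (a : Fin n → A) :
    ∃ φ : L.Formula (Fin n), φ.Realize a ∧
      ∀ b : Fin n → A, φ.Realize b → ∀ ψ : L.Formula (Fin n), ψ.Realize a → ψ.Realize b := by
  rcases isEmpty_or_nonempty A with hA | hA
  · exact ⟨⊤, by simp, fun b _ ψ h => by rwa [Subsingleton.elim b a]⟩
  by_contra! h
  obtain ⟨N, _, hN, hAN, v, hv, hgen⟩ := exists_generic_model _ (isCofinal_omit a h)
  obtain ⟨e⟩ := hcat N hAN
  choose u hu using fun i => hv (e (a i))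
  obtain ⟨φ, ⟨ψ, hψ, hφψ⟩, hφ⟩ := hgen u
  have := hφ (ψ.relabel u) fun v' hv' => by
    rw [Formula.realize_relabel]
    exact hφψ v' hv'
  rw [Formula.realize_relabel, show v ∘ u = e ∘ a from funext hu,
    StrongHomClass.realize_formula] at this
  exact hψ this

/-- An `ω`-categorical structure realizes finitely many types of `n`-tuples. -/
theorem exists_finite_types [L.IsRelational] [Finite L.Symbols] [Countable A]
    (hcat : OmegaCategorical L A) (n : ℕ) :
    ∃ R : Set (Fin n → A), R.Finite ∧
      ∀ b : Fin n → A, ∃ a ∈ R, ∀ ψ : L.Formula (Fin n), ψ.Realize a → ψ.Realize b := by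
  rcases finite_or_infinite A with hA | hA
  · exact ⟨Set.univ, Set.finite_univ, fun b => ⟨b, trivial, fun _ h => h⟩⟩
  choose φ hφ hφ' using exists_isolating_formula hcat (n := n)
  by_contra! h
  obtain ⟨f, hf⟩ := exists_surjective_nat (Fin n → A)
  choose b hb using fun k => h (f '' Set.Iic k) ((Set.finite_Iic k).image f)
  have hb' : ∀ k l, k ≤ l → ¬ (φ (f k)).Realize (b l) := fun k l hkl hr => by
    obtain ⟨ψ, h1, h2⟩ := hb l (f k) ⟨k, hkl, rfl⟩
    exact h2 (hφ' _ _ hr ψ h1)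
  -- An ultrapower contains a tuple `y` that realizes none of the types realized in `A`; a countable
  -- elementary substructure containing `y` is isomorphic to `A`.
  let U : Ultrafilter ℕ := Filter.hyperfilter ℕ
  let B : Type w := (U : Filter ℕ).Product fun _ => A
  let y : Fin n → B := fun j => ((fun k => b k j : ℕ → A) : B)
  have hy : ∀ k, ¬ (φ (f k)).Realize y := fun k hk => by
    have h1 := (Ultraproduct.realize_formula_cast (φ (f k)) fun j l => b l j).1 hk
    have h2 : ∀ᶠ l in (U : Filter ℕ), k ≤ l :=
      Nat.hyperfilter_le_atTop (Filter.eventually_ge_atTop k)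
    obtain ⟨l, hl, hl'⟩ := (h1.and h2).exists
    exact hb' k l hl' hl
  have hAB : A ≅[L] B := by
    rw [elementarilyEquivalent_iff]
    intro φ
    rw [Ultraproduct.sentence_realize]
    simp
  have hBinf : Infinite B := hAB.infinite
  obtain ⟨S, hS, hScard⟩ := exists_elementarySubstructure_card_eq L (Set.range y)
    Cardinal.aleph0.{w} le_rfl
    (by simp)
    (by
      have : L.card ≤ Cardinal.aleph0 := Cardinal.mk_le_aleph0
      simpa using this)
    (by simp)
  have hSc : Countable S := by
    rw [← Cardinal.mk_le_aleph0_iff]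
    simpa using hScard.le
  obtain ⟨e⟩ := hcat S (hAB.trans S.elementarilyEquivalent.symm)
  let y' : Fin n → S := fun j => ⟨y j, hS ⟨j, rfl⟩⟩
  obtain ⟨k, hk⟩ := hf (e.symm ∘ y')
  have h1 : (φ (f k)).Realize (e.symm ∘ y') := hk ▸ hφ (f k)
  rw [StrongHomClass.realize_formula] at h1
  exact hy k ((S.subtype.map_formula (φ (f k)) y').2 h1)

variable (L) in
/-- Two tuples have the same type. Preserving formulas in one direction suffices, because of
negation. -/
def SameType {α : Type} (a b : α → A) : Prop := ∀ ψ : L.Formula α, ψ.Realize a → ψ.Realize b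

theorem SameType.symm {α : Type} {a b : α → A} (h : SameType L a b) : SameType L b a :=
  fun ψ hb => by
    by_contra ha
    exact h ψ.not (Formula.realize_not.2 ha) hb

theorem SameType.comp {α β : Type} {a b : α → A} (h : SameType L a b) (g : β → α) :
    SameType L (a ∘ g) (b ∘ g) := fun ψ ha => by
  rw [← Formula.realize_relabel] at ha ⊢
  exact h _ ha

/-- The extension step of the back-and-forth argument. -/
theorem SameType.exists_snoc [L.IsRelational] [Finite L.Symbols] (hcat : OmegaCategorical L A)
    {n : ℕ} {a b : Fin n → A} (h : SameType L a b) (c : A) :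
    ∃ d, SameType L (Fin.snoc a c : Fin (n + 1) → A) (Fin.snoc b d) := by
  obtain ⟨φ, hφ, hφ'⟩ := exists_isolating_formula hcat (Fin.snoc a c : Fin (n + 1) → A)
  let g : Fin (n + 1) → Fin n ⊕ Fin 1 := Fin.snoc Sum.inl (Sum.inr 0)
  have hg : ∀ (a : Fin n → A) (c : Fin 1 → A),
      Sum.elim a c ∘ g = (Fin.snoc a (c 0) : Fin (n + 1) → A) := fun a c => by
    rw [Fin.comp_snoc]
    rfl
  have h1 := h ((φ.relabel g).iExs (Fin 1))
  simp only [Formula.realize_iExs, Formula.realize_relabel, hg] at h1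
  obtain ⟨d, hd⟩ := h1 ⟨fun _ => c, hφ⟩
  exact ⟨d 0, hφ' _ hd⟩

variable (L A) in
/-- A pair of tuples of the same type: a finite partial map that is elementary. -/
def PartialElem : Type w := Σ n, {p : (Fin n → A) × (Fin n → A) // SameType L p.1 p.2}

/-- Partial elementary maps are ordered by extension. -/
instance : Preorder (PartialElem L A) where
  le p q := ∀ i, ∃ j, q.2.1.1 j = p.2.1.1 i ∧ q.2.1.2 j = p.2.1.2 i
  le_refl _ i := ⟨i, rfl, rfl⟩
  le_trans _ _ _ h h' i := by
    obtain ⟨j, h1, h2⟩ := h i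
    obtain ⟨k, h3, h4⟩ := h' j
    exact ⟨k, h3.trans h1, h4.trans h2⟩

/-- Tuples of the same type in a countable `ω`-categorical structure are conjugate under
automorphisms, by back-and-forth. -/
theorem SameType.exists_equiv [L.IsRelational] [Finite L.Symbols] [Countable A]
    (hcat : OmegaCategorical L A) {n : ℕ} {a b : Fin n → A} (h : SameType L a b) :
    ∃ g : A ≃[L] A, ∀ i, g (a i) = b i := by
  let D : A ⊕ A → Order.Cofinal (PartialElem L A) := Sum.elim
    (fun c => ⟨{p | ∃ i, p.2.1.1 i = c}, fun ⟨n, p, hp⟩ => by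
      obtain ⟨d, hd⟩ := hp.exists_snoc hcat c
      exact ⟨⟨n + 1, ((Fin.snoc p.1 c : Fin (n + 1) → A), (Fin.snoc p.2 d : Fin (n + 1) → A)), hd⟩,
        ⟨Fin.last n, Fin.snoc_last (α := fun _ => A) _ _⟩,
        fun i => ⟨i.castSucc, Fin.snoc_castSucc (α := fun _ => A) _ _ _,
          Fin.snoc_castSucc (α := fun _ => A) _ _ _⟩⟩⟩)
    (fun c => ⟨{p | ∃ i, p.2.1.2 i = c}, fun ⟨n, p, hp⟩ => by
      obtain ⟨d, hd⟩ := hp.symm.exists_snoc hcat c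
      exact ⟨⟨n + 1, ((Fin.snoc p.1 d : Fin (n + 1) → A), (Fin.snoc p.2 c : Fin (n + 1) → A)),
          hd.symm⟩,
        ⟨Fin.last n, Fin.snoc_last (α := fun _ => A) _ _⟩,
        fun i => ⟨i.castSucc, Fin.snoc_castSucc (α := fun _ => A) _ _ _,
          Fin.snoc_castSucc (α := fun _ => A) _ _ _⟩⟩⟩)
  let _ := Encodable.ofCountable (A ⊕ A)
  let p₀ : PartialElem L A := ⟨n, (a, b), h⟩
  let s := Order.sequenceOfCofinals p₀ D
  have hs : Monotone s := Order.sequenceOfCofinals.monotone p₀ D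
  have hmem : ∀ i, ∃ k, s k ∈ D i := fun i => ⟨_, Order.sequenceOfCofinals.encode_mem p₀ D i⟩
  let r : A → A → Prop := fun x y => ∃ k i, (s k).2.1.1 i = x ∧ (s k).2.1.2 i = y
  have hr : ∀ {m : ℕ} {x y : Fin m → A}, (∀ i, r (x i) (y i)) → SameType L x y := by
    intro m x y hxy
    choose k i hx hy using hxy
    choose j hj1 hj2 using fun l => hs (Finset.le_sup (f := k) (Finset.mem_univ l)) (i l)
    have h1 := (s (Finset.univ.sup k)).2.2.comp j
    convert h1 using 1
    · exact funext fun l => ((hj1 l).trans (hx l)).symm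
    · exact funext fun l => ((hj2 l).trans (hy l)).symm
  have heq : ∀ {x x' y y'}, r x y → r x' y' → (x = x' ↔ y = y') := by
    intro x x' y y' h1 h2
    have h3 : SameType L ![x, x'] ![y, y'] := hr (Fin.forall_fin_two.2 ⟨h1, h2⟩)
    have h4 := h3 (Term.equal (Term.var 0) (Term.var 1))
    have h5 := h3.symm (Term.equal (Term.var 0) (Term.var 1))
    simp only [Formula.realize_equal, Term.realize_var, Matrix.cons_val_zero,
      Matrix.cons_val_one] at h4 h5
    exact ⟨h4, h5⟩
  have htot : ∀ x, ∃ y, r x y := fun x => by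
    obtain ⟨k, i, hi⟩ := hmem (Sum.inl x)
    exact ⟨_, k, i, hi, rfl⟩
  have hsurj : ∀ y, ∃ x, r x y := fun y => by
    obtain ⟨k, i, hi⟩ := hmem (Sum.inr y)
    exact ⟨_, k, i, rfl, hi⟩
  choose f hf using htot
  choose f' hf' using hsurj
  refine ⟨⟨⟨f, f', fun x => ?_, fun y => ?_⟩, fun F => isEmptyElim F, fun R x => ?_⟩, fun i => ?_⟩
  · exact (heq (hf' _) (hf _)).2 rfl
  · exact (heq (hf _) (hf' _)).1 rfl
  · have h1 : SameType L x (f ∘ x) := hr fun i => hf (x i)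
    have h2 := h1 (R.formula fun i => Term.var i)
    have h3 := h1.symm (R.formula fun i => Term.var i)
    simp only [Formula.realize_rel, Term.realize_var] at h2 h3
    exact ⟨h3, h2⟩
  · exact (heq (hf _) ⟨0, i, rfl, rfl⟩).1 rfl

/-- In a countable `ω`-categorical structure, orbits of tuples are definable. -/
theorem exists_orbit_formula [L.IsRelational] [Finite L.Symbols] [Countable A]
    (hcat : OmegaCategorical L A) {α : Type} [Finite α] (a : α → A) :
    ∃ φ : L.Formula α, ∀ b, φ.Realize b ↔ ∃ g : A ≃[L] A, g ∘ a = b := by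
  obtain ⟨n, ⟨e⟩⟩ := Finite.exists_equiv_fin α
  obtain ⟨φ, hφ, hφ'⟩ := exists_isolating_formula hcat (a ∘ e.symm)
  refine ⟨φ.relabel e.symm, fun b => ?_⟩
  rw [Formula.realize_relabel]
  constructor
  · intro hb
    obtain ⟨g, hg⟩ := SameType.exists_equiv hcat (hφ' _ hb)
    exact ⟨g, funext fun i => by simpa using hg (e i)⟩
  · rintro ⟨g, rfl⟩
    rw [Function.comp_assoc, StrongHomClass.realize_formula]
    exact hφ

/-- In a countable `ω`-categorical structure there are finitely many orbits of `α`-tuples. -/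
theorem exists_finite_orbits [L.IsRelational] [Finite L.Symbols] [Countable A]
    (hcat : OmegaCategorical L A) (α : Type) [Finite α] :
    ∃ R : Set (α → A), R.Finite ∧ ∀ b, ∃ a ∈ R, ∃ g : A ≃[L] A, g ∘ a = b := by
  obtain ⟨n, ⟨e⟩⟩ := Finite.exists_equiv_fin α
  obtain ⟨R, hR, hR'⟩ := exists_finite_types hcat n
  refine ⟨(· ∘ e) '' R, hR.image _, fun b => ?_⟩
  obtain ⟨a, ha, hab⟩ := hR' (b ∘ e.symm)
  obtain ⟨g, hg⟩ := SameType.exists_equiv hcat hab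
  exact ⟨_, ⟨a, ha, rfl⟩, g, funext fun i => by simpa using hg (e i)⟩

/-- Elementary self-embeddings of a countable `ω`-categorical structure agree on finite sets with
automorphisms. -/
theorem exists_equiv_eqOn [L.IsRelational] [Finite L.Symbols] [Countable A]
    (hcat : OmegaCategorical L A) (H : A ↪ₑ[L] A) (s : Finset A) :
    ∃ g : A ≃[L] A, ∀ a ∈ s, g a = H a := by
  let a : Fin s.card → A := fun i => s.equivFin.symm i
  have h : SameType L a (H ∘ a) := fun ψ hψ => (H.map_formula ψ a).2 hψ
  obtain ⟨g, hg⟩ := h.exists_equiv hcat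
  exact ⟨g, fun x hx => by simpa [a] using hg (s.equivFin ⟨x, hx⟩)⟩

end ModelTheory

/-! ### Counting by inclusion-exclusion -/

/-- Interchanging the sums leaves, for each `f`, the alternating sum over the subsets of the
nonempty set `(J f)ᶜ`. -/
theorem sum_neg_one_pow_card_filter_subset {κ E : Type*} [Fintype κ] [DecidableEq κ] [Fintype E]
    (J : E → Finset κ) (hJ : ∀ f, J f ≠ Finset.univ) :
    ∑ I : Finset κ, (-1 : ℤ) ^ I.card * ((Finset.univ.filter fun f => J f ⊆ Iᶜ).card : ℤ) = 0 := by
  simp only [Finset.card_filter, Nat.cast_sum, Finset.mul_sum]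
  rw [Finset.sum_comm]
  refine Finset.sum_eq_zero fun f _ => ?_
  have hne : ((J f)ᶜ).Nonempty := by
    rw [Finset.nonempty_iff_ne_empty, Ne, Finset.compl_eq_empty_iff]
    exact hJ f
  rw [← Finset.sum_powerset_neg_one_pow_card_of_nonempty hne,
    ← Finset.sum_subset (Finset.subset_univ ((J f)ᶜ.powerset))]
  · refine Finset.sum_congr rfl fun I hI => ?_
    have : J f ⊆ Iᶜ := Finset.subset_compl_comm.1 (Finset.mem_powerset.1 hI)
    simp [this]
  · intro I _ hI
    have : ¬ J f ⊆ Iᶜ := fun h => hI (Finset.mem_powerset.2 (Finset.subset_compl_comm.1 h))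
    simp [this]

/-- If no index set `J f` is everything, then by inclusion-exclusion the number of `f` with
`J f = ∅` is determined by the numbers of `f` with `J f ⊆ I`, for nonempty `I`. -/
theorem card_eq_of_card_subset_eq {κ E₁ E₂ : Type*} [Fintype κ] [DecidableEq κ]
    [Fintype E₁] [Fintype E₂] (J₁ : E₁ → Finset κ) (J₂ : E₂ → Finset κ)
    (h₁ : ∀ f, J₁ f ≠ Finset.univ) (h₂ : ∀ f, J₂ f ≠ Finset.univ)
    (h : ∀ I : Finset κ, I.Nonempty →
      (Finset.univ.filter fun f => J₁ f ⊆ I).card = (Finset.univ.filter fun f => J₂ f ⊆ I).card) :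
    (Finset.univ.filter fun f => J₁ f ⊆ ∅).card = (Finset.univ.filter fun f => J₂ f ⊆ ∅).card := by
  have hk := (sum_neg_one_pow_card_filter_subset J₁ h₁).trans
    (sum_neg_one_pow_card_filter_subset J₂ h₂).symm
  rw [← Finset.sum_erase_add _ _ (Finset.mem_univ Finset.univ),
    ← Finset.sum_erase_add Finset.univ _ (Finset.mem_univ Finset.univ)] at hk
  have hsum : ∀ I ∈ Finset.univ.erase (Finset.univ : Finset κ),
      (-1 : ℤ) ^ I.card * ((Finset.univ.filter fun f => J₁ f ⊆ Iᶜ).card : ℤ) =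
        (-1 : ℤ) ^ I.card * ((Finset.univ.filter fun f => J₂ f ⊆ Iᶜ).card : ℤ) := fun I hI => by
    rw [h Iᶜ]
    rw [Finset.nonempty_iff_ne_empty, Ne, Finset.compl_eq_empty_iff]
    exact (Finset.mem_erase.1 hI).1
  rw [Finset.sum_congr rfl hsum] at hk
  have h3 := add_left_cancel hk
  rw [Finset.compl_univ] at h3
  exact_mod_cast mul_left_cancel₀ (pow_ne_zero _ (by norm_num)) h3

/-! ### Group actions with least supports -/

section Action

variable {G A Ω ι : Type*} [Group G] [MulAction G A] [MulAction G Ω] {n : ι → ℕ}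

/-- `g` fixes the set `T` of atoms pointwise. -/
def Fixes (T : Finset A) (g : G) : Prop := ∀ a ∈ T, g • a = a

theorem Fixes.mono {T S : Finset A} {g : G} (h : Fixes S g) (hTS : T ⊆ S) : Fixes T g :=
  fun a ha => h a (hTS ha)

theorem Fixes.inv {T : Finset A} {g : G} (h : Fixes T g) : Fixes T g⁻¹ :=
  fun a ha => inv_smul_eq_iff.2 (h a ha).symm

variable (G) in
/-- `supp` assigns to each object its least support. -/
structure LeastSupport (supp : Ω → Finset A) : Prop where
  smul_eq : ∀ (g : G) x, Fixes (supp x) g → g • x = x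
  subset : ∀ x V, (∀ g : G, Fixes V g → g • x = x) → supp x ⊆ V

namespace LeastSupport

variable {supp : Ω → Finset A} (hs : LeastSupport G supp)
include hs

theorem mem_supp_of_smul (g : G) {x : Ω} {a : A} (h : a ∈ supp (g • x)) : g⁻¹ • a ∈ supp x := by
  classical
  have := hs.subset (g • x) ((supp x).image (g • ·)) (fun k hk => by
    have h2 := hs.smul_eq (g⁻¹ * k * g) x fun b hb => by
      rw [mul_smul, mul_smul, hk _ (Finset.mem_image_of_mem _ hb), inv_smul_smul]
    rwa [mul_smul, mul_smul, inv_smul_eq_iff] at h2) h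
  obtain ⟨b, hb, rfl⟩ := Finset.mem_image.1 this
  rwa [inv_smul_smul]

theorem smul_mem_supp_smul (g : G) {x : Ω} {a : A} : g • a ∈ supp (g • x) ↔ a ∈ supp x := by
  refine ⟨fun h => by simpa using hs.mem_supp_of_smul g h, fun h => ?_⟩
  have := hs.mem_supp_of_smul g⁻¹ (x := g • x) (a := a) (by rwa [inv_smul_smul])
  rwa [inv_inv] at this

theorem smul_eq_smul {x : Ω} {g k : G} (h : ∀ a ∈ supp x, g • a = k • a) : g • x = k • x := by
  have := hs.smul_eq (k⁻¹ * g) x fun a ha => by rw [mul_smul, h a ha, inv_smul_smul]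
  rwa [mul_smul, inv_smul_eq_iff] at this

end LeastSupport

variable (G) in
/-- The self-map `H` of the atoms behaves on finite sets like an element of `G` and fixes `T`
pointwise; every element of `G` fixing `T` is carried by `H` to an element fixing `S`. -/
structure DenseMap (T S : Finset A) (H : A → A) : Prop where
  fix : ∀ t ∈ T, H t = t
  agree : ∀ s : Finset A, ∃ g : G, ∀ a ∈ s, g • a = H a
  lift : ∀ g : G, Fixes T g → ∃ τ : G, Fixes S τ ∧ ∀ a, τ • H a = H (g • a)

variable (G) in
/-- All atoms of `P` lie outside `T` and are moved by `G`. -/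
def Free (T P : Finset A) : Prop := ∀ a ∈ P, a ∉ T ∧ ¬ ∀ g : G, g • a = a

variable (G A) in
/-- An atom fixed by the pointwise stabilizer of `T` is in `T` or fixed by all of `G`. -/
def TrivialClosure : Prop :=
  ∀ (T : Finset A) (a : A), (∀ g : G, Fixes T g → g • a = a) → a ∈ T ∨ ∀ g : G, g • a = a

theorem DenseMap.injective {T S : Finset A} {H : A → A} (hH : DenseMap G T S H) :
    Function.Injective H := fun a b hab => by
  classical
  obtain ⟨g, hg⟩ := hH.agree {a, b}
  rw [← hg a (by simp), ← hg b (by simp)] at hab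
  exact MulAction.injective g hab

/-- The image of a dense map for `T ⊆ S` avoids the free atoms of `S`: if `H a` is one of them, then
`a` is fixed by the stabilizer of `T`. -/
theorem DenseMap.notMem {T S P : Finset A} {H : A → A} (hH : DenseMap G T S H)
    (hcl : TrivialClosure G A) (hP : Free G T P) (hPS : P ⊆ S) (a : A) : H a ∉ P := by
  intro ha
  obtain ⟨h1, h2⟩ := hP _ ha
  rcases hcl T a fun g hg => by
    obtain ⟨τ, hτ, hτH⟩ := hH.lift g hg
    exact hH.injective ((hτH a).symm.trans (hτ _ (hPS ha))) with h | h
  · exact h1 (by rwa [hH.fix a h])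
  · obtain ⟨g, hg⟩ := hH.agree {a}
    rw [← hg a (by simp), h g] at h2
    exact h2 h

theorem Free.smul {T P : Finset A} (hP : Free G T P) [DecidableEq A] {g : G} (hg : Fixes T g) :
    Free G T (P.image (g • ·)) := by
  intro a ha
  obtain ⟨b, hb, rfl⟩ := Finset.mem_image.1 ha
  obtain ⟨h1, h2⟩ := hP b hb
  refine ⟨fun h => h1 ?_, fun h => h2 fun k => ?_⟩
  · have := hg.inv _ h
    rw [inv_smul_smul] at this
    rwa [this]
  · have := h (g * k * g⁻¹)
    rwa [mul_smul, mul_smul, inv_smul_smul, smul_left_cancel_iff] at this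

/-- A free finite set of atoms has infinitely many disjoint copies over `T`. -/
theorem exists_disjoint_copies (hcl : TrivialClosure G A)
    (hd : ∀ T S : Finset A, T ⊆ S → ∃ H : A → A, DenseMap G T S H) {T P : Finset A}
    (hP : Free G T P) :
    ∃ g : ℕ → G, (∀ i, Fixes T (g i)) ∧ ∀ i j, i ≠ j → ∀ a ∈ P, ∀ b ∈ P, g i • a ≠ g j • b := by
  classical
  have : Std.Symm fun g k : G => ∀ a ∈ P, ∀ b ∈ P, g • a ≠ k • b :=
    ⟨fun g k h a ha b hb hab => h b hb a ha hab.symm⟩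
  suffices hnext : ∀ s : Finset G, (∀ g ∈ s, Fixes T g) →
      ∃ k, Fixes T k ∧ ∀ g ∈ s, ∀ a ∈ P, ∀ b ∈ P, g • a ≠ k • b by
    obtain ⟨g, hg, hg'⟩ := exists_seq_of_forall_finset_exists' (Fixes T)
      (fun g k : G => ∀ a ∈ P, ∀ b ∈ P, g • a ≠ k • b) hnext
    exact ⟨g, hg, fun i j hij => hg' hij⟩
  intro s hs
  let Q : Finset A := s.biUnion fun g => P.image (g • ·)
  have hQ : Free G T Q := fun a ha => by
    obtain ⟨g, hg, ha⟩ := Finset.mem_biUnion.1 ha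
    exact hP.smul (hs g hg) a ha
  obtain ⟨H, hH⟩ := hd T (T ∪ Q) Finset.subset_union_left
  obtain ⟨k, hk⟩ := hH.agree (T ∪ P)
  refine ⟨k, fun a ha => ?_, fun g hg a ha b hb hab => ?_⟩
  · rw [hk a (Finset.mem_union_left _ ha), hH.fix a ha]
  · refine hH.notMem hcl hQ Finset.subset_union_right b ?_
    rw [← hk b (Finset.mem_union_right _ hb), ← hab]
    exact Finset.mem_biUnion.2 ⟨g, hg, Finset.mem_image_of_mem _ ha⟩

/-! ### Equivariant maps of structures -/

/-- A relational structure whose elements and symbols are objects in `Ω`; symbols of the sort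
`r : ι` have arity `n r`. -/
structure ObjStructure (Ω : Type*) {ι : Type*} (n : ι → ℕ) where
  carrier : Set Ω
  rel : (r : ι) → Ω → (Fin (n r) → Ω) → Prop

namespace ObjStructure

variable (G) in
/-- The structure is invariant under the pointwise stabilizer of `T`. -/
structure Invariant (T : Finset A) (M : ObjStructure Ω n) : Prop where
  smul_mem : ∀ g : G, Fixes T g → ∀ x ∈ M.carrier, g • x ∈ M.carrier
  rel_smul : ∀ g : G, Fixes T g → ∀ r σ a,
    M.rel r (g • σ) (fun i => g • a i) ↔ M.rel r σ a

/-- `f` is an embedding of structures up to the translation `κ` of symbols, where `Sym` are the sets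
of symbols. -/
structure IsEmbedding (Sym : ι → Set Ω) (κ : Ω → Ω) (M N : ObjStructure Ω n)
    (f : M.carrier → N.carrier) : Prop where
  injective : Function.Injective f
  rel_iff : ∀ r, ∀ σ ∈ Sym r, ∀ a : Fin (n r) → M.carrier,
    M.rel r σ (fun i => a i) ↔ N.rel r (κ σ) (fun i => f (a i))

theorem IsEmbedding.comp {Sym : ι → Set Ω} {κ : Ω → Ω} {M N X : ObjStructure Ω n}
    {k : N.carrier → X.carrier} {f : M.carrier → N.carrier} (hk : IsEmbedding Sym id N X k)
    (hf : IsEmbedding Sym κ M N f) (hκ : ∀ r, ∀ σ ∈ Sym r, κ σ ∈ Sym r) :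
    IsEmbedding Sym κ M X (k ∘ f) :=
  ⟨hk.injective.comp hf.injective, fun r σ hσ a =>
    (hf.rel_iff r σ hσ a).trans (hk.rel_iff r _ (hκ r σ hσ) _)⟩

variable (G) in
/-- `f` commutes with the elements of `G` fixing `S`. -/
def Equivariant (S : Finset A) {M N : Set Ω} (f : M → N) : Prop :=
  ∀ g : G, Fixes S g → ∀ x y : M, (y : Ω) = g • (x : Ω) → (f y : Ω) = g • (f x : Ω)

variable (G A) in
/-- For every finite `T`, the pointwise stabilizer of `T` has finitely many orbits on `M`. -/
def OrbitFinite (M : Set Ω) : Prop :=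
  ∀ T : Finset A, ∃ R : Finset M, ∀ x ∈ M, ∃ g : G, Fixes T g ∧ ∃ r ∈ R, g • (r : Ω) = x

theorem OrbitFinite.finite_supp_subset {M : Set Ω} (hM : OrbitFinite G A M) {supp : Ω → Finset A}
    (hs : LeastSupport G supp) (V : Finset A) : {x : M | supp x ⊆ V}.Finite := by
  obtain ⟨R, hR⟩ := hM V
  refine R.finite_toSet.subset fun x hx => ?_
  obtain ⟨g, hg, r, hr, hrx⟩ := hR x x.2
  have : g⁻¹ • (x : Ω) = x := hs.smul_eq _ _ (hg.inv.mono hx)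
  rw [← hrx, inv_smul_smul, hrx] at this
  rwa [← Subtype.ext this]

theorem OrbitFinite.exists_card_supp_le {M : Set Ω} (hM : OrbitFinite G A M)
    {supp : Ω → Finset A} (hs : LeastSupport G supp) : ∃ d, ∀ x ∈ M, (supp x).card ≤ d := by
  obtain ⟨R, hR⟩ := hM ∅
  refine ⟨R.sup fun r => (supp r).card, fun x hx => ?_⟩
  obtain ⟨g, -, r, hr, rfl⟩ := hR x hx
  refine (Finset.card_le_card_of_injOn (g⁻¹ • ·) (fun a ha => hs.mem_supp_of_smul g ha)
    (MulAction.injective _).injOn).trans ?_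
  exact Finset.le_sup (f := fun r : M => (supp r).card) hr

/-- Equivariant maps do not enlarge supports beyond the parameters. -/
theorem Equivariant.supp_subset {S : Finset A} {M N : Set Ω} {f : M → N}
    (hf : Equivariant G S f) {supp : Ω → Finset A} (hs : LeastSupport G supp) [DecidableEq A]
    (x : M) : supp (f x) ⊆ supp x ∪ S :=
  hs.subset _ _ fun g hg => (hf g (hg.mono Finset.subset_union_right) x x
    (hs.smul_eq g x (hg.mono Finset.subset_union_left)).symm).symm

/-- `f` is equivariant along `H`: it intertwines the elements of `G` fixing `T` with the
elements fixing `V` to which `H` carries them, and the support of `f x` lies in `V` and the image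
under `H` of the support of `x`. Under a dense map `H` such an `f` stands for an equivariant map
into the objects that are built from `H(A)` and the parameters `V`. -/
structure IsShifted (supp : Ω → Finset A) (G : Type*) [Group G] [MulAction G A] [MulAction G Ω]
    (T V : Finset A) (H : A → A) {M X : Set Ω} (f : M → X) : Prop where
  smul_eq : ∀ g τ : G, Fixes T g → Fixes V τ → (∀ a, τ • H a = H (g • a)) →
    ∀ x y : M, (y : Ω) = g • (x : Ω) → (f y : Ω) = τ • (f x : Ω)
  supp_subset : ∀ x, ∀ a ∈ supp (f x), a ∈ V ∨ ∃ b ∈ supp (x : Ω), H b = a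

theorem IsShifted.comp {supp : Ω → Finset A} (hs : LeastSupport G supp) {T V S : Finset A}
    {H : A → A} {M X Y : Set Ω} {k : X → Y} {f : M → X} (hf : IsShifted supp G T V H f)
    (hk : Equivariant G S k) (hSV : S ⊆ V) : IsShifted supp G T V H (k ∘ f) := by
  classical
  refine ⟨fun g τ hg hτ h x y hxy => ?_, fun x a ha => ?_⟩
  · exact hk τ (hτ.mono hSV) _ _ (hf.smul_eq g τ hg hτ h x y hxy)
  · rcases Finset.mem_union.1 (hk.supp_subset hs _ ha) with h | h
    · exact hf.supp_subset x a h
    · exact Or.inl (hSV h)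

/-- A map equivariant along `H` is determined by its values on finitely many orbit representatives,
and there are finitely many candidates with the required support for each of these values. -/
theorem OrbitFinite.finite_isShifted {M X : Set Ω} (hM : OrbitFinite G A M)
    (hX : OrbitFinite G A X) {supp : Ω → Finset A} (hs : LeastSupport G supp) {T V : Finset A}
    {H : A → A} (hH : ∀ g : G, Fixes T g → ∃ τ : G, Fixes V τ ∧ ∀ a, τ • H a = H (g • a)) :
    {f : M → X | IsShifted supp G T V H f}.Finite := by
  classical
  obtain ⟨R, hR⟩ := hM T
  have hfin : ∀ r : R, Finite {y : X | supp y ⊆ (supp (r : M)).image H ∪ V} :=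
    fun r => hX.finite_supp_subset hs _
  let Φ : {f : M → X | IsShifted supp G T V H f} →
      ∀ r : R, {y : X | supp y ⊆ (supp (r : M)).image H ∪ V} :=
    fun f r => ⟨f.1 r, fun a ha => by
      rcases f.2.supp_subset r a ha with h | ⟨b, hb, rfl⟩
      · exact Finset.mem_union_right _ h
      · exact Finset.mem_union_left _ (Finset.mem_image_of_mem _ hb)⟩
  refine Set.finite_coe_iff.1 (Finite.of_injective Φ fun f f' hff' => ?_)
  refine Subtype.ext (funext fun x => Subtype.ext ?_)
  obtain ⟨g, hg, r, hr, hrx⟩ := hR x x.2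
  obtain ⟨τ, hτ, hτH⟩ := hH g hg
  rw [f.2.smul_eq g τ hg hτ hτH r x hrx.symm, f'.2.smul_eq g τ hg hτ hτH r x hrx.symm]
  have h1 : f.1 r = f'.1 r := congrArg Subtype.val (congrFun hff' ⟨r, hr⟩)
  rw [h1]

theorem OrbitFinite.finite_equivariant {M N : Set Ω} (hM : OrbitFinite G A M)
    (hN : OrbitFinite G A N) {supp : Ω → Finset A} (hs : LeastSupport G supp) (T : Finset A) :
    {f : M → N | Equivariant G T f}.Finite := by
  classical
  refine (hM.finite_isShifted hN hs (T := T) (V := T) (H := id)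
    fun g hg => ⟨g, hg, fun _ => rfl⟩).subset fun f hf => ⟨fun g τ hg hτ h x y hxy => ?_,
      fun x a ha => ?_⟩
  · rw [hf g hg x y hxy]
    exact hs.smul_eq_smul fun a _ => (h a).symm
  · rcases Finset.mem_union.1 (Equivariant.supp_subset hf hs x ha) with h | h
    · exact Or.inr ⟨a, h, rfl⟩
    · exact Or.inl h

/-- For pairwise disjoint sets `Q i` of parameters, an equivariant map along a dense map uses
parameters from a number of the `Q i` that is bounded independently of their total number. -/
theorem IsShifted.card_filter_le {supp : Ω → Finset A} (hs : LeastSupport G supp)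
    {T V : Finset A} {H : A → A}
    (hH : ∀ g : G, Fixes T g → ∃ τ : G, Fixes V τ ∧ ∀ a, τ • H a = H (g • a))
    {M X : Set Ω} {f : M → X} (hf : IsShifted supp G T V H f) {κ : Type*} [Fintype κ]
    {Q : κ → Finset A} (hQV : ∀ i, Q i ⊆ V) (hQ : ∀ i j a, a ∈ Q i → a ∈ Q j → i = j)
    {R : Finset M} (hR : ∀ x ∈ M, ∃ g : G, Fixes T g ∧ ∃ r ∈ R, g • (r : Ω) = x)
    {d : ℕ} (hd : ∀ x ∈ X, (supp x).card ≤ d)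
    [DecidablePred fun i => ∃ x : M, ∃ a ∈ supp (f x), a ∈ Q i] :
    (Finset.univ.filter fun i => ∃ x : M, ∃ a ∈ supp (f x), a ∈ Q i).card ≤ R.card * d := by
  classical
  have hmem : ∀ i ∈ Finset.univ.filter fun i => ∃ x : M, ∃ a ∈ supp (f x), a ∈ Q i,
      ∃ a ∈ R.biUnion fun r => supp (f r), a ∈ Q i := fun i hi => by
    obtain ⟨-, x, a, ha, hai⟩ := Finset.mem_filter.1 hi
    obtain ⟨g, hg, r, hr, hrx⟩ := hR x x.2
    obtain ⟨τ, hτ, hτH⟩ := hH g hg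
    rw [hf.smul_eq g τ hg hτ hτH r x hrx.symm, ← hτ a (hQV i hai), hs.smul_mem_supp_smul] at ha
    exact ⟨a, Finset.mem_biUnion.2 ⟨r, hr, ha⟩, hai⟩
  refine (Finset.card_le_card_of_forall_subsingleton (fun i a => a ∈ Q i) hmem
    fun a _ i hi j hj => hQ i j a hi.2 hj.2).trans
    (Finset.card_biUnion_le_card_mul _ _ _ fun r _ => hd _ (f r).2)

end ObjStructure

/-! ### The action of a dense map on objects -/

/-- A dense map acts on objects: on each object it acts like the elements of `G` agreeing with it
on the support. -/
theorem DenseMap.exists_extension {supp : Ω → Finset A}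
    (hs : LeastSupport G supp) {T S : Finset A} {H : A → A} (hH : DenseMap G T S H) :
    ∃ K : Ω → Ω, ∀ (x : Ω) (g : G), (∀ a ∈ supp x, g • a = H a) → K x = g • x := by
  choose g hg using hH.agree
  exact ⟨fun x => g (supp x) • x, fun x k hk =>
    hs.smul_eq_smul fun a ha => (hg _ a ha).trans (hk a ha).symm⟩

section Extension

variable {supp : Ω → Finset A} (hs : LeastSupport G supp) {T S : Finset A} {H : A → A}
  (hH : DenseMap G T S H) {K : Ω → Ω}
  (hK : ∀ (x : Ω) (g : G), (∀ a ∈ supp x, g • a = H a) → K x = g • x)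
include hH hK

theorem extension_injective : Function.Injective K := fun x y hxy => by
  classical
  obtain ⟨g, hg⟩ := hH.agree (supp x ∪ supp y)
  rw [hK x g fun a ha => hg a (Finset.mem_union_left _ ha),
    hK y g fun a ha => hg a (Finset.mem_union_right _ ha)] at hxy
  exact MulAction.injective g hxy

theorem extension_mem {D : Set Ω} (hD : ∀ g : G, Fixes T g → ∀ x ∈ D, g • x ∈ D) {x : Ω}
    (hx : x ∈ D) : K x ∈ D := by
  classical
  obtain ⟨g, hg⟩ := hH.agree (T ∪ supp x)
  rw [hK x g fun a ha => hg a (Finset.mem_union_right _ ha)]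
  exact hD g (fun a ha => (hg a (Finset.mem_union_left _ ha)).trans (hH.fix a ha)) x hx

theorem extension_rel {M : ObjStructure Ω n} (hM : M.Invariant G T) (r : ι) (σ : Ω)
    (a : Fin (n r) → Ω) : M.rel r (K σ) (fun i => K (a i)) ↔ M.rel r σ a := by
  classical
  obtain ⟨g, hg⟩ := hH.agree (T ∪ supp σ ∪ Finset.univ.biUnion fun i => supp (a i))
  rw [hK σ g fun b hb => hg b (by simp [hb]),
    funext fun i => hK (a i) g fun b hb => hg b (by
      simp only [Finset.mem_union, Finset.mem_biUnion]
      exact Or.inr ⟨i, Finset.mem_univ _, hb⟩)]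
  exact hM.rel_smul g (fun b hb => (hg b (by simp [hb])).trans (hH.fix b hb)) r σ a

include hs in
theorem extension_smul {g τ : G} (h : ∀ a, τ • H a = H (g • a)) (x : Ω) :
    K (g • x) = τ • K x := by
  classical
  obtain ⟨k, hk⟩ := hH.agree (supp x ∪ supp (g • x))
  rw [hK _ k fun a ha => hk a (Finset.mem_union_right _ ha),
    hK _ k fun a ha => hk a (Finset.mem_union_left _ ha), ← mul_smul, ← mul_smul]
  refine hs.smul_eq_smul fun a ha => ?_
  rw [mul_smul, mul_smul, hk a (Finset.mem_union_left _ ha), h,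
    hk _ (Finset.mem_union_right _ ((hs.smul_mem_supp_smul g).2 ha))]

include hs in
theorem mem_supp_extension {x : Ω} {a : A} (ha : a ∈ supp (K x)) : ∃ b ∈ supp x, H b = a := by
  obtain ⟨g, hg⟩ := hH.agree (supp x)
  rw [hK x g hg] at ha
  have h := hs.mem_supp_of_smul g ha
  exact ⟨_, h, by rw [← hg _ h, smul_inv_smul]⟩

include hs in
/-- An object of an invariant set supported by `T` and atoms of the form `H b` comes from an
object of that set. -/
theorem exists_extension_eq {D : Set Ω} (hD : ∀ g : G, Fixes T g → ∀ x ∈ D, g • x ∈ D) {y : Ω}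
    (hy : y ∈ D) (hsupp : ∀ a ∈ supp y, ∃ b, H b = a) : ∃ x ∈ D, K x = y := by
  classical
  choose! b hb using hsupp
  obtain ⟨g, hg⟩ := hH.agree (T ∪ (supp y).image b)
  refine ⟨g⁻¹ • y, hD _ (Fixes.inv fun a ha =>
    (hg a (Finset.mem_union_left _ ha)).trans (hH.fix a ha)) y hy, ?_⟩
  rw [hK _ g fun a ha => ?_, smul_inv_smul]
  have h1 := hs.mem_supp_of_smul g⁻¹ ha
  rw [inv_inv] at h1
  have h2 := hg (b (g • a)) (Finset.mem_union_right _ (Finset.mem_image_of_mem _ h1))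
  rw [hb _ h1] at h2
  rw [← hb _ h1, MulAction.injective g h2]

end Extension

end Action

namespace ObjStructure

variable {G A Ω ι : Type*} [Group G] [MulAction G A] [MulAction G Ω] {n : ι → ℕ}

/-! ### Parameter elimination for group actions -/

theorem Equivariant.symm {S : Finset A} {M N : Set Ω} {e : M ≃ N} (he : Equivariant G S e)
    (hM : ∀ g : G, Fixes S g → ∀ x ∈ M, g • x ∈ M) : Equivariant G S e.symm := by
  intro g hg x y hxy
  let z : M := ⟨g • (e.symm x : Ω), hM g hg _ (e.symm x).2⟩
  have h1 : e z = y := Subtype.ext (by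
    rw [he g hg (e.symm x) z rfl, e.apply_symm_apply, hxy])
  rw [← h1, e.symm_apply_apply]

theorem IsEmbedding.symm {Sym : ι → Set Ω} {M N : ObjStructure Ω n} {e : M.carrier ≃ N.carrier}
    (he : IsEmbedding Sym id M N e) : IsEmbedding Sym id N M e.symm :=
  ⟨e.symm.injective, fun r σ hσ a => by
    have := he.rel_iff r σ hσ fun i => e.symm (a i)
    simp only [e.apply_symm_apply] at this
    exact this.symm⟩

/-- Conjugating an embedding by an element fixing `T` moves its parameters. -/
theorem IsEmbedding.exists_conj {T S S' : Finset A} {Sym : ι → Set Ω}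
    (hSym : ∀ r, ∀ g : G, Fixes T g → ∀ σ ∈ Sym r, g • σ ∈ Sym r) {M N : ObjStructure Ω n}
    (hM : M.Invariant G T) (hN : N.Invariant G T) {f : M.carrier → N.carrier}
    (hf : IsEmbedding Sym id M N f) (hfS : Equivariant G S f) {g : G} (hg : Fixes T g)
    (hS : ∀ a ∈ S, g • a ∈ S') :
    ∃ f' : M.carrier → N.carrier, IsEmbedding Sym id M N f' ∧ Equivariant G S' f' := by
  let c : M.carrier → M.carrier := fun x => ⟨g⁻¹ • (x : Ω), hM.smul_mem _ hg.inv _ x.2⟩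
  refine ⟨fun x => ⟨g • (f (c x) : Ω), hN.smul_mem g hg _ (f _).2⟩, ⟨fun x y hxy => ?_,
    fun r σ hσ a => ?_⟩, fun k hk x y hxy => ?_⟩
  · have h1 : c x = c y :=
      hf.injective (Subtype.ext (MulAction.injective g (congrArg Subtype.val hxy)))
    exact Subtype.ext (MulAction.injective g⁻¹ (congrArg Subtype.val h1))
  · rw [← hM.rel_smul g⁻¹ hg.inv]
    refine (hf.rel_iff r _ (hSym r _ hg.inv σ hσ) fun i => c (a i)).trans ?_
    rw [← hN.rel_smul g hg]
    simp
  · have h1 : Fixes S (g⁻¹ * k * g) := fun a ha => by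
      rw [mul_smul, mul_smul, hk _ (hS a ha), inv_smul_smul]
    have h2 := hfS _ h1 (c x) (c y) (by simp [c, mul_smul, hxy])
    change g • (f (c y) : Ω) = k • g • (f (c x) : Ω)
    rw [h2, mul_smul, mul_smul, smul_inv_smul]

/-- Parameter elimination for embeddings. The embeddings of `M` into `N` and into `M` along a dense
map `H`, with parameters from a family of disjoint copies `Q i` of the given ones, are counted
according to the set of indices `i` that they use; composing with the given maps shows that equally
many of them use indices from `I` only, for each nonempty `I`, so by inclusion-exclusion this also
holds for `I = ∅`. Since `H` itself is an embedding without additional parameters into `M`, there is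
one into `N`. -/
theorem exists_equivariant_embedding {supp : Ω → Finset A} (hs : LeastSupport G supp)
    (hcl : TrivialClosure G A)
    (hd : ∀ T S : Finset A, T ⊆ S → ∃ H : A → A, DenseMap G T S H) {T S : Finset A}
    {Sym : ι → Set Ω} (hSym : ∀ r, ∀ g : G, Fixes T g → ∀ σ ∈ Sym r, g • σ ∈ Sym r)
    {M N : ObjStructure Ω n} (hM : M.Invariant G T) (hN : N.Invariant G T)
    (hMf : OrbitFinite G A M.carrier) (hNf : OrbitFinite G A N.carrier)
    {e : M.carrier → N.carrier} (he : IsEmbedding Sym id M N e) (heS : Equivariant G S e)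
    {e' : N.carrier → M.carrier} (he' : IsEmbedding Sym id N M e') (heS' : Equivariant G S e') :
    ∃ i : M.carrier → N.carrier, IsEmbedding Sym id M N i ∧ Equivariant G T i := by
  classical
  -- Parameters in `T` or fixed by all of `G` can be discarded.
  let P : Finset A := S.filter fun a => a ∉ T ∧ ¬ ∀ g : G, g • a = a
  have hP : Free G T P := fun a ha => (Finset.mem_filter.1 ha).2
  have hPS : ∀ g : G, Fixes (T ∪ P) g → Fixes S g := fun g hg a ha => by
    by_cases h1 : a ∈ T
    · exact hg a (Finset.mem_union_left _ h1)
    · by_cases h2 : ∀ g : G, g • a = a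
      · exact h2 g
      · exact hg a (Finset.mem_union_right _ (Finset.mem_filter.2 ⟨ha, h1, h2⟩))
  obtain ⟨R, hR⟩ := hMf T
  obtain ⟨dM, hdM⟩ := hMf.exists_card_supp_le hs
  obtain ⟨dN, hdN⟩ := hNf.exists_card_supp_le hs
  obtain ⟨g, hg, hgP⟩ := exists_disjoint_copies hcl hd hP
  -- One copy more than a single map can use.
  let m := R.card * max dM dN + 1
  let Q : Fin m → Finset A := fun i => P.image (g i • ·)
  have hQfree : ∀ i, Free G T (Q i) := fun i => hP.smul (hg i)
  have hQ : ∀ i j a, a ∈ Q i → a ∈ Q j → i = j := fun i j a hi hj => by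
    obtain ⟨b, hb, hba⟩ := Finset.mem_image.1 hi
    obtain ⟨c, hc, hca⟩ := Finset.mem_image.1 hj
    by_contra hij
    exact hgP i j (fun h => hij (Fin.ext h)) b hb c hc (hba.trans hca.symm)
  let V : Finset A := T ∪ Finset.univ.biUnion Q
  have hTV : T ⊆ V := Finset.subset_union_left
  have hQV : ∀ i, Q i ⊆ V := fun i =>
    (Finset.subset_biUnion_of_mem Q (Finset.mem_univ i)).trans Finset.subset_union_right
  obtain ⟨H, hH⟩ := hd T V hTV
  obtain ⟨K, hK⟩ := hH.exists_extension hs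
  have hKinj : Function.Injective K := extension_injective hH hK
  let E : ObjStructure Ω n → Type _ := fun X =>
    {f : M.carrier → X.carrier // IsEmbedding Sym K M X f ∧ IsShifted supp G T V H f}
  let J : ∀ {X}, E X → Finset (Fin m) := fun f =>
    Finset.univ.filter fun i => ∃ x : M.carrier, ∃ a ∈ supp (f.1 x), a ∈ Q i
  have hE : ∀ X : ObjStructure Ω n, OrbitFinite G A X.carrier → Finite (E X) := fun X hX =>
    ((hMf.finite_isShifted hX hs hH.lift).subset fun f hf => hf.2).to_subtype
  have hJ : ∀ (X : ObjStructure Ω n) (d : ℕ), d ≤ max dM dN →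
      (∀ x ∈ X.carrier, (supp x).card ≤ d) → ∀ f : E X, J f ≠ Finset.univ := by
    intro X d hdd hX f hf
    have h1 := f.2.2.card_filter_le hs hH.lift hQV hQ hR hX
    change (J f).card ≤ _ at h1
    rw [hf, Finset.card_univ, Fintype.card_fin] at h1
    have h2 := Nat.mul_le_mul_left R.card hdd
    omega
  -- Composition with `k` only adds parameters from `Q i`.
  have hle : ∀ (X Y : ObjStructure Ω n) [Fintype (E X)] [Fintype (E Y)] (i : Fin m)
      (k : X.carrier → Y.carrier), IsEmbedding Sym id X Y k → Equivariant G (T ∪ Q i) k →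
      ∀ I : Finset (Fin m), i ∈ I → (Finset.univ.filter fun f : E X => J f ⊆ I).card ≤
        (Finset.univ.filter fun f : E Y => J f ⊆ I).card := by
    intro X Y _ _ i k hk hkS I hi
    have hSV : T ∪ Q i ⊆ V := Finset.union_subset hTV (hQV i)
    refine Finset.card_le_card_of_injOn (fun f => ⟨k ∘ f.1,
      hk.comp f.2.1 fun r σ hσ => extension_mem hH hK (hSym r) hσ, f.2.2.comp hs hkS hSV⟩)
      (fun f hf => ?_) fun f _ f' _ hff' => ?_
    · refine Finset.mem_coe.2 (Finset.mem_filter.2 ⟨Finset.mem_univ _, fun j hj => ?_⟩)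
      have hf := (Finset.mem_filter.1 (Finset.mem_coe.1 hf)).2
      obtain ⟨-, x, a, ha, haj⟩ := Finset.mem_filter.1 hj
      rcases Finset.mem_union.1 (hkS.supp_subset hs _ ha) with h | h
      · exact hf (Finset.mem_filter.2 ⟨Finset.mem_univ _, x, a, h, haj⟩)
      · rcases Finset.mem_union.1 h with h | h
        · exact absurd h (hQfree j a haj).1
        · rwa [hQ j i a haj h]
    · refine Subtype.ext (funext fun x => hk.injective ?_)
      exact congrFun (congrArg Subtype.val hff') x
  let _ : Fintype (E M) := @Fintype.ofFinite _ (hE M hMf)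
  let _ : Fintype (E N) := @Fintype.ofFinite _ (hE N hNf)
  have hcard := card_eq_of_card_subset_eq (J (X := M)) (J (X := N))
    (hJ M dM (le_max_left _ _) hdM) (hJ N dN (le_max_right _ _) hdN) fun I ⟨i, hi⟩ => by
      have hgi : ∀ a ∈ T ∪ P, g i • a ∈ T ∪ Q i := fun a ha => by
        rcases Finset.mem_union.1 ha with h | h
        · exact Finset.mem_union_left _ (by rwa [hg i a h])
        · exact Finset.mem_union_right _ (Finset.mem_image_of_mem _ h)
      obtain ⟨k, hk, hkS⟩ := he.exists_conj hSym hM hN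
        (fun c hc => heS c (hPS c hc)) (hg i) hgi
      obtain ⟨k', hk', hkS'⟩ := he'.exists_conj hSym hN hM
        (fun c hc => heS' c (hPS c hc)) (hg i) hgi
      exact le_antisymm (hle M N i k hk hkS I hi) (hle N M i k' hk' hkS' I hi)
  -- The map induced by `H` itself.
  let f₀ : E M := ⟨fun x => ⟨K x, extension_mem hH hK hM.smul_mem x.2⟩,
    ⟨fun x y hxy => Subtype.ext (hKinj (congrArg Subtype.val hxy)),
      fun r σ _ a => (extension_rel hH hK hM r σ _).symm⟩,
    ⟨fun c τ _ _ h x y hxy => by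
      change K y = τ • K x
      rw [hxy]
      exact extension_smul hs hH hK h x,
      fun x a ha => Or.inr (mem_supp_extension hs hH hK ha)⟩⟩
  have hf₀ : J f₀ ⊆ ∅ := fun i hi => by
    obtain ⟨-, x, a, ha, hai⟩ := Finset.mem_filter.1 hi
    obtain ⟨b, -, rfl⟩ := mem_supp_extension hs hH hK ha
    exact absurd hai (hH.notMem hcl (hQfree i) (hQV i) b)
  have hpos : 0 < (Finset.univ.filter fun f : E N => J f ⊆ ∅).card := by
    rw [← hcard]
    exact Finset.card_pos.2 ⟨f₀, Finset.mem_filter.2 ⟨Finset.mem_univ _, hf₀⟩⟩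
  obtain ⟨f, hf⟩ := Finset.card_pos.1 hpos
  have hf := (Finset.mem_filter.1 hf).2
  have hfH : ∀ x, ∃ y ∈ N.carrier, K y = f.1 x := fun x => by
    refine exists_extension_eq hs hH hK hN.smul_mem (f.1 x).2 fun a ha => ?_
    rcases f.2.2.supp_subset x a ha with h | ⟨b, -, hb⟩
    · rcases Finset.mem_union.1 h with h | h
      · exact ⟨a, hH.fix a h⟩
      · obtain ⟨i, -, hi⟩ := Finset.mem_biUnion.1 h
        exact absurd (hf (Finset.mem_filter.2 ⟨Finset.mem_univ _, x, a, ha, hi⟩))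
          (Finset.notMem_empty i)
    · exact ⟨b, hb⟩
  choose y hy hKy using hfH
  refine ⟨fun x => ⟨y x, hy x⟩, ⟨fun x x' hxx' => ?_, fun r σ hσ a => ?_⟩, fun c hc x x' hxx' => ?_⟩
  · refine f.2.1.injective (Subtype.ext ?_)
    rw [← hKy, ← hKy]
    exact congrArg K (congrArg Subtype.val hxx')
  · rw [f.2.1.rel_iff r σ hσ a]
    simp only [← hKy]
    exact extension_rel hH hK hN r σ _
  · obtain ⟨τ, hτ, hτH⟩ := hH.lift c hc
    refine hKinj ?_
    rw [hKy, extension_smul hs hH hK hτH, hKy]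
    exact f.2.2.smul_eq c τ hc hτ hτH x x' hxx'

/-- Parameter elimination: structures invariant under the pointwise stabilizer of `T` that embed
into each other equivariantly with respect to some finite set of parameters are isomorphic
equivariantly with respect to `T`. -/
theorem exists_equivariant_isomorphism {supp : Ω → Finset A} (hs : LeastSupport G supp)
    (hcl : TrivialClosure G A)
    (hd : ∀ T S : Finset A, T ⊆ S → ∃ H : A → A, DenseMap G T S H) {T S : Finset A}
    {Sym : ι → Set Ω} (hSym : ∀ r, ∀ g : G, Fixes T g → ∀ σ ∈ Sym r, g • σ ∈ Sym r)
    {M N : ObjStructure Ω n} (hM : M.Invariant G T) (hN : N.Invariant G T)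
    (hMf : OrbitFinite G A M.carrier) (hNf : OrbitFinite G A N.carrier)
    {e : M.carrier → N.carrier} (he : IsEmbedding Sym id M N e) (heS : Equivariant G S e)
    {e' : N.carrier → M.carrier} (he' : IsEmbedding Sym id N M e') (heS' : Equivariant G S e') :
    ∃ i : M.carrier ≃ N.carrier, IsEmbedding Sym id M N i ∧ Equivariant G T i := by
  obtain ⟨i, hi, hiT⟩ :=
    exists_equivariant_embedding hs hcl hd hSym hM hN hMf hNf he heS he' heS'
  obtain ⟨j, hj, hjT⟩ :=
    exists_equivariant_embedding hs hcl hd hSym hN hM hNf hMf he' heS' he heS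
  have hij : Function.Injective (i ∘ j) := hi.injective.comp hj.injective
  have hiter : ∀ m : ℕ, Equivariant G T (i ∘ j)^[m] := by
    intro m
    induction m with
    | zero => exact fun g _ x y h => h
    | succ m ih =>
      intro g hg x y h
      rw [Function.iterate_succ_apply', Function.iterate_succ_apply']
      exact hiT g hg _ _ (hjT g hg _ _ (ih g hg x y h))
  have : Finite {f : N.carrier → N.carrier | Equivariant G T f} :=
    (hNf.finite_equivariant hNf hs T).to_subtype
  obtain ⟨a, b, hab, heq⟩ := Finite.exists_ne_map_eq_of_infinite
    fun m : ℕ => (⟨(i ∘ j)^[m], hiter m⟩ : {f : N.carrier → N.carrier | Equivariant G T f})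
  have hsurj : Function.Surjective i := by
    wlog hlt : a < b generalizing a b
    · exact this b a hab.symm heq.symm (by omega)
    intro y
    obtain ⟨c, rfl⟩ := Nat.exists_eq_add_of_lt hlt
    have h1 := congrFun (congrArg Subtype.val heq) y
    simp only [add_assoc, Function.iterate_add_apply _ a] at h1
    have h2 := hij.iterate a h1
    rw [Function.iterate_succ_apply'] at h2
    exact ⟨_, h2.symm⟩
  exact ⟨Equiv.ofBijective i ⟨hi.injective, hsurj⟩, hi, hiT⟩

end ObjStructure

namespace Obj

variable {A : Type w}

/-! ### Renaming atoms and Kuratowski pairs -/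

theorem map_id (x : Obj A) : map id x = x := by
  induction x using Quotient.inductionOn with
  | h x =>
  refine congrArg (Quotient.mk _) ?_
  induction x with
  | atom a => rfl
  | family κ f ih => simp only [PreObj.map, ih]

theorem map_comp (π ρ : A → A) (x : Obj A) : map (π ∘ ρ) x = map π (map ρ x) := by
  induction x using Quotient.inductionOn with
  | h x =>
  refine congrArg (Quotient.mk _) ?_
  induction x with
  | atom a => rfl
  | family κ f ih => simp only [PreObj.map, ih]

theorem mem_map (π : A → A) (x z : Obj A) : z ∈ map π x ↔ ∃ y ∈ x, map π y = z := by
  induction x using Quotient.inductionOn with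
  | h x =>
  induction z using Quotient.inductionOn with
  | h z =>
  cases x with
  | atom a => exact ⟨fun h => h.elim, fun ⟨y, hy, _⟩ => by
      induction y using Quotient.inductionOn
      exact hy.elim⟩
  | family κ f =>
    constructor
    · rintro ⟨i, hi⟩
      exact ⟨Quotient.mk _ (f i), ⟨i, PreObj.Equiv.rfl' _⟩, Quotient.sound hi.symm'⟩
    · rintro ⟨y, hy, hyz⟩
      induction y using Quotient.inductionOn with
      | h y =>
      obtain ⟨i, hi⟩ := hy
      have h1 : PreObj.Equiv _ _ := Quotient.exact hyz
      exact ⟨i, h1.symm'.trans' (PreObj.map_congr π hi)⟩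

theorem isSet_map {π : A → A} {x : Obj A} (hx : x.IsSet) : (map π x).IsSet := by
  induction x using Quotient.inductionOn with
  | h x =>
  cases x with
  | atom a => exact absurd rfl (hx a)
  | family κ f =>
    intro a h
    have h' : PreObj.Equiv _ _ := Quotient.exact h
    simp [PreObj.Equiv, PreObj.map] at h'

theorem isSet_of_mem {x z : Obj A} (h : z ∈ x) : x.IsSet := by
  rintro a rfl
  induction z using Quotient.inductionOn
  exact h.elim

theorem map_range (π : A → A) {κ : Type w} (f : κ → Obj A) :
    map π (range f) = range fun i => map π (f i) := by
  refine ext_of_isSet (isSet_map (isSet_range f)) (isSet_range _) fun z => ?_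
  rw [mem_map, mem_range]
  simp [mem_range]

theorem mem_upair (x y z : Obj A) : z ∈ upair x y ↔ z = x ∨ z = y := by
  rw [upair, mem_range]
  constructor
  · rintro ⟨⟨b⟩, rfl⟩
    cases b <;> simp
  · rintro (rfl | rfl)
    · exact ⟨⟨true⟩, rfl⟩
    · exact ⟨⟨false⟩, rfl⟩

theorem isSet_upair (x y : Obj A) : (upair x y).IsSet := isSet_range _

theorem map_upair (π : A → A) (x y : Obj A) : map π (upair x y) = upair (map π x) (map π y) := by
  rw [upair, map_range, upair]
  refine congrArg range (funext fun ⟨b⟩ => ?_)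
  cases b <;> rfl

theorem map_pair (π : A → A) (x y : Obj A) : map π (pair x y) = pair (map π x) (map π y) := by
  simp only [pair, map_upair]

theorem upair_eq {x y x' y' : Obj A} (h : upair x y = upair x' y') (z : Obj A) :
    z = x ∨ z = y ↔ z = x' ∨ z = y' := by
  rw [← mem_upair, h, mem_upair]

theorem pair_injective {x y x' y' : Obj A} (h : pair x y = pair x' y') : x = x' ∧ y = y' := by
  have h1 := upair_eq h
  have hx : x = x' := by
    rcases (h1 (upair x x)).1 (Or.inr rfl) with h2 | h2
    · have := (upair_eq h2 x').2 (Or.inl rfl)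
      simpa [eq_comm] using this
    · have := (upair_eq h2 x').2 (Or.inl rfl)
      simpa [eq_comm] using this
  subst hx
  refine ⟨rfl, ?_⟩
  rcases (h1 (upair x y)).1 (Or.inl rfl) with h2 | h2
  · rcases (upair_eq h2 y).1 (Or.inr rfl) with h3 | h3
    · rcases (upair_eq h2 y').2 (Or.inr rfl) with h4 | h4
      · exact h3.trans h4.symm
      · exact h4.symm
    · exact h3
  · have h3 : y = x := by simpa using (upair_eq h2 y).1 (Or.inr rfl)
    rcases (h1 (upair x y')).2 (Or.inl rfl) with h4 | h4
    · have := (upair_eq h4 y').1 (Or.inr rfl)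
      rcases this with h5 | h5
      · exact h3.trans h5.symm
      · exact h5.symm
    · have := (upair_eq h4 y').1 (Or.inr rfl)
      simp only [or_self] at this
      exact h3.trans this.symm

theorem map_tuple (π : A → A) : ∀ {n : ℕ} (x : Fin (n + 1) → Obj A),
    map π (tuple x) = tuple fun i => map π (x i)
  | 0, _ => rfl
  | _ + 1, x => by
    rw [tuple, map_pair, map_tuple π, tuple]
    rfl

end Obj

/-! ### Definable objects -/

section Definability

variable {L : FirstOrder.Language.{u, v}} {A : Type w} [L.Structure A]

/-- Renaming the free variables of an expression. -/
def SetExpr.rename : {α β : Type} → (α → β) → SetExpr L α → SetExpr L β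
  | _, _, g, .var x => .var (g x)
  | _, _, g, .union m n e φ => .union m n (fun i => (e i).rename (Sum.map g id))
      fun i => (φ i).relabel (Sum.map g id)

theorem SetExpr.mem_value_union {α : Type} {m : ℕ} {n : Fin m → ℕ}
    {e : ∀ i, SetExpr L (α ⊕ Fin (n i))} {φ : ∀ i, L.Formula (α ⊕ Fin (n i))} {val : α → A}
    {z : Obj A} : z ∈ (SetExpr.union m n e φ).value val ↔
      ∃ i b, (φ i).Realize (Sum.elim val b) ∧ (e i).value (Sum.elim val b) = z := by
  rw [SetExpr.value, Obj.mem_range]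
  exact ⟨fun ⟨⟨i, b, hb⟩, h⟩ => ⟨i, b, hb, h⟩, fun ⟨i, b, hb, h⟩ => ⟨⟨i, b, hb⟩, h⟩⟩

theorem SetExpr.isSet_value_union {α : Type} {m : ℕ} {n : Fin m → ℕ}
    {e : ∀ i, SetExpr L (α ⊕ Fin (n i))} {φ : ∀ i, L.Formula (α ⊕ Fin (n i))} {val : α → A} :
    ((SetExpr.union m n e φ).value val).IsSet := by
  rw [SetExpr.value]
  exact Obj.isSet_range _

theorem SetExpr.value_rename {α β : Type} (g : α → β) (e : SetExpr L α) (val : β → A) :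
    (e.rename g).value val = e.value (val ∘ g) := by
  induction e generalizing β with
  | var x => rfl
  | union m n e φ ih =>
    rw [rename]
    refine Obj.ext_of_isSet isSet_value_union isSet_value_union fun z => ?_
    rw [mem_value_union, mem_value_union]
    have h : ∀ i (b : Fin (n i) → A), Sum.elim val b ∘ Sum.map g id = Sum.elim (val ∘ g) b :=
      fun i b => by rw [Sum.elim_comp_map, Function.comp_id]
    simp only [ih, Formula.realize_relabel, h]

theorem SetExpr.map_value {α : Type} (π : A ≃[L] A) (e : SetExpr L α) (val : α → A) :
    Obj.map π (e.value val) = e.value (π ∘ val) := by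
  induction e with
  | var x => rfl
  | union m n e φ ih =>
    refine Obj.ext_of_isSet (Obj.isSet_map isSet_value_union) isSet_value_union fun z => ?_
    rw [Obj.mem_map, mem_value_union]
    simp only [mem_value_union]
    constructor
    · rintro ⟨_, ⟨i, b, hb, rfl⟩, rfl⟩
      refine ⟨i, π ∘ b, ?_, ?_⟩
      · rw [← Sum.comp_elim, StrongHomClass.realize_formula]
        exact hb
      · rw [ih, Sum.comp_elim]
    · rintro ⟨i, b, hb, rfl⟩
      have hπ : Sum.elim (π ∘ val) b = π ∘ Sum.elim val (π.symm ∘ b) := by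
        rw [Sum.comp_elim, ← Function.comp_assoc]
        congr 1
        funext x
        simp
      refine ⟨_, ⟨i, π.symm ∘ b, ?_, rfl⟩, ?_⟩
      · rwa [hπ, StrongHomClass.realize_formula] at hb
      · rw [ih, hπ]

theorem DefinableOver.supports {S : Finset A} {x : Obj A} (h : DefinableOver L S x) :
    Supports L S x := by
  obtain ⟨k, e, val, hval, rfl⟩ := h
  intro π hπ
  rw [SetExpr.map_value]
  exact congrArg _ (funext fun i => hπ _ (hval i))

variable (L) in
/-- Definability with some finite set of parameters. -/
def ParamDefinable (x : Obj A) : Prop := ∃ S : Finset A, DefinableOver L S x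

theorem paramDefinable_value {α : Type} [Finite α] (e : SetExpr L α) (val : α → A) :
    ParamDefinable L (e.value val) := by
  classical
  obtain ⟨k, ⟨g⟩⟩ := Finite.exists_equiv_fin α
  refine ⟨Finset.univ.image (val ∘ g.symm), k, e.rename g, val ∘ g.symm,
    fun i => Finset.mem_image_of_mem _ (Finset.mem_univ i), ?_⟩
  rw [SetExpr.value_rename, Function.comp_assoc, Equiv.symm_comp_self, Function.comp_id]

theorem paramDefinable_atom (a : A) : ParamDefinable L (Obj.atom a) :=
  paramDefinable_value (.var 0 : SetExpr L (Fin 1)) fun _ => a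

theorem ParamDefinable.of_mem {x y : Obj A} (hx : ParamDefinable L x) (hy : y ∈ x) :
    ParamDefinable L y := by
  obtain ⟨S, k, e, val, -, rfl⟩ := hx
  cases e with
  | var i => exact absurd rfl (Obj.isSet_of_mem hy (val i))
  | union m n e φ =>
    obtain ⟨i, b, -, rfl⟩ := SetExpr.mem_value_union.1 hy
    exact paramDefinable_value _ _

theorem ParamDefinable.map {x : Obj A} (hx : ParamDefinable L x) (π : A ≃[L] A) :
    ParamDefinable L (Obj.map π x) := by
  obtain ⟨S, k, e, val, -, rfl⟩ := hx
  rw [SetExpr.map_value]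
  exact paramDefinable_value _ _

theorem ParamDefinable.upair {x y : Obj A} (hx : ParamDefinable L x) (hy : ParamDefinable L y) :
    ParamDefinable L (Obj.upair x y) := by
  obtain ⟨-, k, e, val, -, rfl⟩ := hx
  obtain ⟨-, k', e', val', -, rfl⟩ := hy
  let E : Fin 2 → SetExpr L ((Fin k ⊕ Fin k') ⊕ Fin 0) :=
    ![e.rename (Sum.inl ∘ Sum.inl), e'.rename (Sum.inl ∘ Sum.inr)]
  convert paramDefinable_value (SetExpr.union 2 (fun _ => 0) E fun _ => ⊤)
    (Sum.elim val val') using 1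
  refine Obj.ext_of_isSet (Obj.isSet_upair _ _) SetExpr.isSet_value_union fun z => ?_
  rw [Obj.mem_upair, SetExpr.mem_value_union]
  have h1 : ∀ b : Fin 0 → A, Sum.elim (Sum.elim val val') b ∘ Sum.inl ∘ Sum.inl = val :=
    fun _ => rfl
  have h2 : ∀ b : Fin 0 → A, Sum.elim (Sum.elim val val') b ∘ Sum.inl ∘ Sum.inr = val' :=
    fun _ => rfl
  simp [Fin.exists_fin_two, E, SetExpr.value_rename, h1, h2, eq_comm]

theorem ParamDefinable.pair {x y : Obj A} (hx : ParamDefinable L x) (hy : ParamDefinable L y) :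
    ParamDefinable L (Obj.pair x y) :=
  (hx.upair hy).upair (hx.upair hx)

/-- The union of finitely many orbits of definable objects under the pointwise stabilizer of `T` is
`T`-definable. -/
theorem exists_definableOver_orbits [L.IsRelational] [Finite L.Symbols] [Countable A]
    (hcat : OmegaCategorical L A) (T : Finset A) {m : ℕ} (x : Fin m → Obj A)
    (hx : ∀ j, ParamDefinable L (x j)) :
    ∃ Γ : Obj A, DefinableOver L T Γ ∧ Γ.IsSet ∧
      ∀ z, z ∈ Γ ↔ ∃ j, ∃ π : A ≃[L] A, (∀ t ∈ T, π t = t) ∧ Obj.map π (x j) = z := by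
  choose S k e val _ hval using hx
  let t : Fin T.card → A := fun i => T.equivFin.symm i
  choose φ hφ using fun j => exists_orbit_formula hcat (Sum.elim t (val j))
  refine ⟨_, ⟨T.card, SetExpr.union m k (fun j => (e j).rename Sum.inr) φ, t,
    fun i => (T.equivFin.symm i).2, rfl⟩, SetExpr.isSet_value_union, fun z => ?_⟩
  rw [SetExpr.mem_value_union]
  refine exists_congr fun j => ?_
  constructor
  · rintro ⟨b, hb, rfl⟩
    obtain ⟨π, hπ⟩ := (hφ j _).1 hb
    refine ⟨π, fun a ha => ?_, ?_⟩
    · simpa [t] using congrFun hπ (Sum.inl (T.equivFin ⟨a, ha⟩))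
    · rw [← hval, SetExpr.map_value, SetExpr.value_rename]
      exact congrArg _ (funext fun i => congrFun hπ (Sum.inr i))
  · rintro ⟨π, hπ, rfl⟩
    refine ⟨π ∘ val j, (hφ j _).2 ⟨π, ?_⟩, ?_⟩
    · rw [Sum.comp_elim]
      exact congrArg (Sum.elim · _) (funext fun i => hπ _ (T.equivFin.symm i).2)
    · rw [← hval, SetExpr.map_value, SetExpr.value_rename]
      rfl

/-- Definable sets are orbit-finite. -/
theorem ParamDefinable.exists_finite_orbits [L.IsRelational] [Finite L.Symbols] [Countable A]
    (hcat : OmegaCategorical L A) {x : Obj A} (hx : ParamDefinable L x) (T : Finset A) :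
    ∃ R : Set (Obj A), R.Finite ∧ (∀ y ∈ R, y ∈ x) ∧
      ∀ y ∈ x, ∃ π : A ≃[L] A, (∀ t ∈ T, π t = t) ∧ ∃ r ∈ R, Obj.map π r = y := by
  obtain ⟨-, k, e, val, -, rfl⟩ := hx
  cases e with
  | var i => exact ⟨∅, Set.finite_empty, fun y hy => hy.elim,
      fun y hy => absurd rfl (Obj.isSet_of_mem hy (val i))⟩
  | union m n e φ =>
    let t : Fin T.card → A := fun i => T.equivFin.symm i
    choose R hR hR' using fun i =>
      SetsWithAtoms.exists_finite_orbits hcat (Fin T.card ⊕ (Fin k ⊕ Fin (n i)))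
    have := fun i => (hR i).to_subtype
    have key : ∀ y ∈ (SetExpr.union m n e φ).value val, ∃ p : Σ i, R i, ∃ (b : Fin (n p.1) → A)
        (π : A ≃[L] A), π ∘ p.2.1 = Sum.elim t (Sum.elim val b) ∧
          (e p.1).value (Sum.elim val b) = y := fun y hy => by
      obtain ⟨i, b, -, hb⟩ := SetExpr.mem_value_union.1 hy
      obtain ⟨a, ha, π, hπ⟩ := hR' i (Sum.elim t (Sum.elim val b))
      exact ⟨⟨i, a, ha⟩, b, π, hπ, hb⟩
    choose p hp using fun y : {y // y ∈ (SetExpr.union m n e φ).value val} => key y y.2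
    refine ⟨Set.range fun q : Set.range p => (q.2.choose : Obj A), Set.finite_range _, ?_,
      fun y hy => ?_⟩
    · rintro _ ⟨q, rfl⟩
      exact q.2.choose.2
    · let q : Set.range p := ⟨p ⟨y, hy⟩, ⟨y, hy⟩, rfl⟩
      obtain ⟨b, π, hπ, hb⟩ := hp ⟨y, hy⟩
      have h1 := hp q.2.choose
      rw [q.2.choose_spec] at h1
      obtain ⟨b', π', hπ', hb'⟩ := h1
      have h2 : (π.comp π'.symm) ∘ Sum.elim t (Sum.elim val b') =
          Sum.elim t (Sum.elim val b) := by
        rw [← hπ, ← hπ']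
        funext i
        simp only [Function.comp_apply, FirstOrder.Language.Equiv.comp_apply,
          FirstOrder.Language.Equiv.symm_apply_apply]
        rfl
      have h3 : ∀ i, (π.comp π'.symm) (Sum.elim t (Sum.elim val b') i) =
          Sum.elim t (Sum.elim val b) i := congrFun h2
      refine ⟨π.comp π'.symm, fun a ha => ?_, _, ⟨q, rfl⟩, ?_⟩
      · have h4 := h3 (Sum.inl (T.equivFin ⟨a, ha⟩))
        simp only [Sum.elim_inl, t, Equiv.symm_apply_apply] at h4
        exact h4
      · refine (congrArg _ hb'.symm).trans (Eq.trans ?_ hb)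
        rw [SetExpr.map_value]
        exact congrArg _ (funext fun i => h3 (Sum.inr i))

end Definability

/-! ### Automorphisms of the atoms -/

section Automorphisms

variable {L : FirstOrder.Language.{u, v}} {A : Type w} [L.Structure A]

/-- The automorphism group of the atoms. -/
instance : Group (A ≃[L] A) where
  mul g h := g.comp h
  one := FirstOrder.Language.Equiv.refl L A
  inv g := g.symm
  mul_assoc _ _ _ := FirstOrder.Language.Equiv.ext fun _ => rfl
  one_mul _ := FirstOrder.Language.Equiv.ext fun _ => rfl
  mul_one _ := FirstOrder.Language.Equiv.ext fun _ => rfl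
  inv_mul_cancel g := FirstOrder.Language.Equiv.ext fun x => g.symm_apply_apply x

instance : MulAction (A ≃[L] A) A where
  smul g a := g a
  one_smul _ := rfl
  mul_smul _ _ _ := rfl

variable (L A) in
/-- The definable objects; automorphisms act on them by renaming atoms. -/
def DefObj : Type (w + 1) := {x : Obj A // ParamDefinable L x}

instance : MulAction (A ≃[L] A) (DefObj L A) where
  smul g x := ⟨Obj.map g x.1, x.2.map g⟩
  one_smul x := Subtype.ext (Obj.map_id x.1)
  mul_smul g h x := Subtype.ext (Obj.map_comp g h x.1)

/-- An atom `a` outside `T` fixed by the stabilizer of `T` is supported by `T` and by `{a}`, so its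
least support is empty. -/
theorem trivialClosure (hsupp : HasLeastSupports L A) : TrivialClosure (A ≃[L] A) A := by
  classical
  intro T a ha
  by_cases haT : a ∈ T
  · exact Or.inl haT
  obtain ⟨U, hU, hU'⟩ := hsupp (Obj.atom a) (paramDefinable_atom a)
  have h1 : U ⊆ T := hU' fun π hπ => congrArg Obj.atom (ha π hπ)
  have h2 : U ⊆ {a} := hU' fun π hπ => congrArg Obj.atom (hπ a (Finset.mem_singleton_self a))
  refine Or.inr fun g => Obj.atom_injective (hU g fun s hs => ?_)
  exact absurd (Finset.mem_singleton.1 (h2 hs) ▸ h1 hs) haT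

theorem exists_leastSupport (hsupp : HasLeastSupports L A) :
    ∃ supp : DefObj L A → Finset A, LeastSupport (A ≃[L] A) supp := by
  choose supp h h' using fun x : DefObj L A => hsupp x.1 x.2
  exact ⟨supp, fun g x hg => Subtype.ext (h x g hg),
    fun x V hV => h' x fun π hπ => congrArg Subtype.val (hV π hπ)⟩

theorem exists_denseMap [L.IsRelational] [Finite L.Symbols] [Countable A]
    (hcat : OmegaCategorical L A) (hdense : DenseAtoms L A) {T S : Finset A} (hTS : T ⊆ S) :
    ∃ H : A → A, DenseMap (A ≃[L] A) T S H := by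
  obtain ⟨H, hT, hH⟩ := hdense T S hTS
  refine ⟨H, hT, exists_equiv_eqOn hcat H, fun g hg => ?_⟩
  let E : A ≃[L] H.toHom.range := H.toEmbedding.equivRange
  have hE : ∀ a, (E a : A) = H a := fun a => rfl
  obtain ⟨τ, hτ, hτH⟩ := hH (E.comp (g.comp E.symm)) fun x hx => by
    obtain ⟨a, rfl⟩ := E.surjective x
    have h1 : H a = a := by
      refine H.injective ?_
      rw [hE] at hx
      exact hT _ hx
    have h2 : g a = a := hg a (by rwa [hE, h1] at hx)
    change (E (g (E.symm (E a))) : A) = _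
    rw [E.symm_apply_apply, h2]
  refine ⟨τ, hτ, fun a => (hτH (E a)).trans ?_⟩
  change (E (g (E.symm (E a))) : A) = _
  rw [E.symm_apply_apply]
  rfl

/-- The definable elements of a set are orbit-finite. -/
theorem orbitFinite_mem [L.IsRelational] [Finite L.Symbols] [Countable A]
    (hcat : OmegaCategorical L A) {x : Obj A} (hx : ParamDefinable L x) :
    ObjStructure.OrbitFinite (A ≃[L] A) A {y : DefObj L A | y.1 ∈ x} := by
  classical
  intro T
  obtain ⟨R, hR, hRx, hR'⟩ := hx.exists_finite_orbits hcat T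
  have := hR.to_subtype
  have := Fintype.ofFinite R
  refine ⟨Finset.univ.image fun r : R => ⟨⟨r, hx.of_mem (hRx r r.2)⟩, hRx r r.2⟩, fun y hy => ?_⟩
  obtain ⟨π, hπ, r, hr, hry⟩ := hR' y.1 hy
  exact ⟨π, hπ, _, Finset.mem_image_of_mem _ (Finset.mem_univ ⟨r, hr⟩), Subtype.ext hry⟩

/-- A set supported by `T` is invariant under the pointwise stabilizer of `T`. -/
theorem Supports.map_mem_iff {T : Finset A} {x : Obj A} (hx : Supports L T x) {π : A ≃[L] A}
    (hπ : ∀ t ∈ T, π t = t) {z : Obj A} : Obj.map π z ∈ x ↔ z ∈ x := by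
  constructor
  · intro h
    rw [← hx π hπ, Obj.mem_map] at h
    obtain ⟨y, hy, hyz⟩ := h
    have h1 := congrArg (Obj.map π.symm) hyz
    rw [← Obj.map_comp, ← Obj.map_comp, show (π.symm : A → A) ∘ π = id from
      funext fun a => π.symm_apply_apply a, Obj.map_id, Obj.map_id] at h1
    rwa [← h1]
  · intro h
    rw [← hx π hπ, Obj.mem_map]
    exact ⟨z, h, rfl⟩

end Automorphisms

/-! ### Definable structures -/

section Structures

variable {L : FirstOrder.Language.{u, v}} {A : Type w} [L.Structure A] {Sg : RelSignature A}

variable (L) in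
/-- A relational structure in the universe of sets with atoms, seen as a structure on the definable
objects. -/
def RelStructure.toObj (M : RelStructure Sg) :
    ObjStructure (DefObj L A) fun r : Fin Sg.maxArity => (r : ℕ) + 1 where
  carrier := {x | x.1 ∈ M.carrier}
  rel r σ a := Obj.tuple (Fin.cons σ.1 fun i => (a i).1 : Fin (r + 2) → Obj A) ∈ M.interp r

theorem RelStructure.invariant_toObj {M : RelStructure Sg} {T : Finset A}
    (hM : M.IsDefinable L T) : (M.toObj L).Invariant (A ≃[L] A) T where
  smul_mem g hg x hx := (hM.1.supports.map_mem_iff hg).2 hx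
  rel_smul g hg r σ a := by
    refine Iff.trans ?_ ((hM.2 r).supports.map_mem_iff hg)
    rw [Obj.map_tuple]
    refine iff_of_eq (congrArg (fun z => Obj.tuple z ∈ M.interp r) ?_)
    funext i
    refine Fin.cases rfl (fun i => rfl) i

/-- The elements of a definable structure are definable. -/
def RelStructure.elemEquiv {M : RelStructure Sg} (hM : ParamDefinable L M.carrier) :
    M.Elem ≃ (M.toObj L).carrier where
  toFun x := ⟨⟨x.1, hM.of_mem x.2⟩, x.2⟩
  invFun x := ⟨x.1.1, x.2⟩
  left_inv _ := rfl
  right_inv _ := rfl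

theorem IsDefinableFun.equivariant {S : Finset A} {M N : RelStructure Sg}
    (hM : ParamDefinable L M.carrier) (hN : ParamDefinable L N.carrier) {h : M.Elem → N.Elem}
    (hh : IsDefinableFun L S h) :
    ObjStructure.Equivariant (A ≃[L] A) S
      (RelStructure.elemEquiv hN ∘ h ∘ (RelStructure.elemEquiv hM).symm) := by
  obtain ⟨Γ, -, hΓ, hdef⟩ := hh
  intro g hg x y hxy
  have h1 := (hΓ _).2 ⟨(RelStructure.elemEquiv hM).symm x, rfl⟩
  rw [← hdef.supports.map_mem_iff hg, Obj.map_pair, hΓ] at h1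
  obtain ⟨z, hz⟩ := h1
  obtain ⟨h2, h3⟩ := Obj.pair_injective hz
  have h4 : z = (RelStructure.elemEquiv hM).symm y :=
    Subtype.ext (h2.symm.trans (congrArg Subtype.val hxy).symm)
  refine Subtype.ext ?_
  rw [h4] at h3
  exact h3.symm

end Structures

end SetsWithAtoms

open SetsWithAtoms in
theorem theorem3p1 (L : FirstOrder.Language.{u, v}) [L.IsRelational] [Finite L.Symbols]
    (A : Type w) [L.Structure A] [Countable A]
    (hcat : SetsWithAtoms.OmegaCategorical L A)
    (hdense : SetsWithAtoms.DenseAtoms L A)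
    (hsupp : SetsWithAtoms.HasLeastSupports L A) :
    SetsWithAtoms.ParameterElimination L A := by
  classical
  intro T Sg M N hSg hM hN ⟨S, h, hiso, hdef⟩
  have hMd : ParamDefinable L M.carrier := ⟨T, hM.1⟩
  have hNd : ParamDefinable L N.carrier := ⟨T, hN.1⟩
  obtain ⟨supp, hs⟩ := exists_leastSupport hsupp
  let Sym : Fin Sg.maxArity → Set (DefObj L A) := fun r => {σ | σ.1 ∈ Sg.symbols r}
  have hSym : ∀ r, ∀ g : A ≃[L] A, Fixes T g → ∀ σ ∈ Sym r, g • σ ∈ Sym r :=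
    fun r g hg σ hσ => ((hSg r).supports.map_mem_iff hg).2 hσ
  let e : (M.toObj L).carrier ≃ (N.toObj L).carrier :=
    (RelStructure.elemEquiv hMd).symm.trans (h.trans (RelStructure.elemEquiv hNd))
  have he : ObjStructure.IsEmbedding Sym id (M.toObj L) (N.toObj L) e :=
    ⟨e.injective, fun r σ hσ a =>
      hiso r σ.1 hσ fun i => (RelStructure.elemEquiv hMd).symm (a i)⟩
  have heS : ObjStructure.Equivariant (A ≃[L] A) (S ∪ T) e := fun g hg =>
    hdef.equivariant hMd hNd g (hg.mono Finset.subset_union_left)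
  have hMf : ObjStructure.OrbitFinite (A ≃[L] A) A (M.toObj L).carrier :=
    orbitFinite_mem hcat hMd
  obtain ⟨i, hi, hiT⟩ := ObjStructure.exists_equivariant_isomorphism hs (trivialClosure hsupp)
    (fun _ _ hTS => exists_denseMap hcat hdense hTS) hSym (RelStructure.invariant_toObj hM)
    (RelStructure.invariant_toObj hN) hMf (orbitFinite_mem hcat hNd) he heS he.symm
    (heS.symm fun g hg => (RelStructure.invariant_toObj hM).smul_mem g
      (hg.mono Finset.subset_union_right))
  refine ⟨(RelStructure.elemEquiv hMd).trans (i.trans (RelStructure.elemEquiv hNd).symm),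
    fun r σ hσ a => hi.rel_iff r ⟨σ, ParamDefinable.of_mem ⟨T, hSg r⟩ hσ⟩ hσ
      fun j => RelStructure.elemEquiv hMd (a j), ?_⟩
  -- The graph is the union of the orbits of its points over representatives of the orbits of `M`.
  obtain ⟨R, hR⟩ := hMf T
  obtain ⟨m, ⟨c⟩⟩ := Finite.exists_equiv_fin R
  let x : Fin m → (M.toObj L).carrier := fun j => (c.symm j : (M.toObj L).carrier)
  obtain ⟨Γ, hΓ, hΓset, hΓmem⟩ := exists_definableOver_orbits hcat T
    (fun j => Obj.pair (x j).1.1 (i (x j)).1.1) fun j => (x j).1.2.pair (i (x j)).1.2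
  refine ⟨Γ, hΓset, fun z => (hΓmem z).trans ⟨?_, ?_⟩, hΓ⟩
  · rintro ⟨j, π, hπ, rfl⟩
    let y : (M.toObj L).carrier :=
      ⟨π • (x j).1, (RelStructure.invariant_toObj hM).smul_mem π hπ _ (x j).2⟩
    refine ⟨(RelStructure.elemEquiv hMd).symm y, ?_⟩
    rw [Obj.map_pair]
    exact congrArg (Obj.pair _) (congrArg Subtype.val (hiT π hπ (x j) y rfl)).symm
  · rintro ⟨y, rfl⟩
    obtain ⟨π, hπ, r, hr, hry⟩ := hR _ (RelStructure.elemEquiv hMd y).2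
    have hx : x (c ⟨r, hr⟩) = r := by simp [x]
    refine ⟨c ⟨r, hr⟩, π, hπ, ?_⟩
    rw [hx, Obj.map_pair]
    have h1 : Obj.map π r.1.1 = y.1 := congrArg Subtype.val hry
    have h2 : Obj.map π (i r).1.1 = (i (RelStructure.elemEquiv hMd y)).1.1 :=
      (congrArg Subtype.val (hiT π hπ r _ hry.symm)).symm
    rw [h1, h2]
    rfl
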